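/- Let $\zeta$ be the Riemann zeta-function. The integral of $\log|\zeta(s)|/|s|^2$ with respect to arc length over the line $\Re s=1/2$ converges absolutely, the series $$\sum_{\beta>1/2}\log\left|\frac{\rho}{1-\rho}\right|,$$ over the nontrivial zeros $\rho=\beta+i\gamma$ of $\zeta$ (the zeros other than the negative even integers) with real part $\beta>1/2$, each repeated according to its multiplicity, converges absolutely (it may be empty), and $$\int_{\Re s=1/2}\frac{\log|\zeta(s)|}{|s|^2}\,|ds| = \int_{-\infty}^{\infty}\frac{\log|\zeta(\tfrac12+it)|}{\tfrac14+t^2}\,dt = 2\pi\sum_{\beta>1/2}\log\left|\frac{\rho}{1-\rho}\right|.$$ In particular, the Riemann Hypothesis (every nontrivial zero of $\zeta$ has real part $1/2$) holds if and only if $$\int_{\Re s=1/2}\frac{\log|\zeta(s)|}{|s|^2}\,|ds|=0.$$ -/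

import Mathlib

/-- The nontrivial zeros of the Riemann zeta-function: its zeros other than the negative even
integers (`s = 1` is the pole, where Mathlib's `riemannZeta` has a conventional value). -/
def nontrivialZetaZeros : Set ℂ :=
  {ρ : ℂ | riemannZeta ρ = 0 ∧ (¬∃ n : ℕ, ρ = -2 * (n + 1)) ∧ ρ ≠ 1}

/-- The nontrivial zeros `ρ = β + iγ` with `β > 1/2`. -/
def zetaZerosRightHalf : Set ℂ :=
  {ρ : ℂ | ρ ∈ nontrivialZetaZeros ∧ 1 / 2 < ρ.re}

/-- The multiplicity of `ρ` as a zero of the zeta-function. -/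
noncomputable def zetaZeroMult (ρ : ℂ) : ℕ := analyticOrderNatAt riemannZeta ρ

/-- The function `log |ζ(s)| / |s|^2`. -/
noncomputable def bsyIntegrand (s : ℂ) : ℝ :=
  Real.log ‖riemannZeta s‖ / ‖s‖ ^ 2

/-- The arc-length parametrization `t ↦ 1/2 + it` of the line `Re s = 1/2`. -/
noncomputable def criticalLine (t : ℝ) : ℂ := 1 / 2 + (t : ℂ) * Complex.I

/-! Put `z = (1 - s)/s`, that is `s = 1/(1 + z)`, which carries `Re s > 1/2` to the unit disc, `s =
1` to `0` and `s = ∞` to `-1`. Let `G(z) = (s - 1) ζ(s) / s` (`zetaDisc`). Then `G(0) = 1`, the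
zeros of `G` in the disc are the points `(1 - ρ)/ρ` with `β > 1/2`, and on the unit circle `|G| =
|ζ|`, because `|s - 1| = |s|` there. Since `|dθ| = |ds|/|s|^2`, the theorem becomes Jensen's formula
for `G` on the unit circle itself: the mean of `log|G|` equals the sum of `-log|z|` over the zeros
in the disc (`IsDiscAdmissible.tsum_blaschkeTerm_eq`).

Jensen's formula holds on every circle of radius `r < 1`; the issue is the limit `r → 1`, where only
the boundary point `-1` is singular. The bound `|G| ≤ K/|1 + z|` gives an integrable majorant of
`log|G|` independent of `r`, so Fatou's lemma yields integrability on the circle and "sum ≤ mean".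

For "mean ≤ sum", negative mass of `log|G|` must not concentrate at `-1` (a singular inner factor).
Jensen's formula is combined with the Poisson–Jensen inequality at `-w`, in the proportion that
makes the resulting kernel vanish at `-r`. That kernel suppresses any mass near `-1`, while away
from `-1` the limit `r → 1` is dominated. The error is controlled by `|G(-w)| ≥ w`, which is `ζ(x) ≥
1` for real `x > 1`, and it disappears as `w → 1`, when the kernel tends to `1`.

All terms of the zero sum are positive, so it vanishes exactly when there is no zero with `β > 1/2`;
by the functional equation this is the Riemann Hypothesis. -/

open Complex Real Set Filter Topology MeasureTheory Metric

/-! ### Poisson–Jensen inequality on a disc -/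

/-- For `u` in the disc of radius `R`, the reflected factor dominates `log ‖w - u‖`. -/
lemma mul_norm_sub_le_norm_sq_sub_conj_mul {R : ℝ} (hR : 0 < R) {u w : ℂ}
    (hu : ‖u‖ ≤ R) (hw : ‖w‖ ≤ R) :
    R * ‖w - u‖ ≤ ‖(R : ℂ) ^ 2 - (starRingEnd ℂ) u * w‖ := by
  have key : ‖(R : ℂ) ^ 2 - (starRingEnd ℂ) u * w‖ ^ 2 - (R * ‖w - u‖) ^ 2
      = (R ^ 2 - ‖u‖ ^ 2) * (R ^ 2 - ‖w‖ ^ 2) := by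
    rw [mul_pow]
    simp only [← Complex.normSq_eq_norm_sq, Complex.normSq_apply]
    simp [pow_two]
    ring
  have h1 : 0 ≤ (R ^ 2 - ‖u‖ ^ 2) * (R ^ 2 - ‖w‖ ^ 2) := by
    apply mul_nonneg <;> nlinarith [norm_nonneg u, norm_nonneg w]
  exact le_of_sq_le_sq (by linarith) (norm_nonneg _)

lemma norm_sq_sub_conj_mul_of_norm_eq {R : ℝ} (hR : 0 < R) {u z : ℂ} (hz : ‖z‖ = R) :
    ‖(R : ℂ) ^ 2 - (starRingEnd ℂ) u * z‖ = R * ‖z - u‖ := by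
  have key : ‖(R : ℂ) ^ 2 - (starRingEnd ℂ) u * z‖ ^ 2 - (R * ‖z - u‖) ^ 2
      = (R ^ 2 - ‖u‖ ^ 2) * (R ^ 2 - ‖z‖ ^ 2) := by
    rw [mul_pow]
    simp only [← Complex.normSq_eq_norm_sq, Complex.normSq_apply]
    simp [pow_two]
    ring
  rw [hz, sub_self, mul_zero, sub_eq_zero] at key
  exact (pow_left_inj₀ (norm_nonneg _) (by positivity) two_ne_zero).1 key

/-- For `‖u‖ < R` the reflected factor `F(z) = (R² - ū z)/R` has no zero in the closed disc, has
modulus `|z - u|` on the circle and at least `|z - u|` inside. The Poisson formula for the harmonic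
function `log|F|` then gives the inequality; for `u` on the circle there is equality. -/
lemma log_norm_sub_le_circleAverage_poissonKernel {R : ℝ} {u w : ℂ}
    (hu : u ∈ closedBall 0 R) (hw : w ∈ ball 0 R) (huw : w ≠ u) :
    Real.log ‖w - u‖ ≤ circleAverage (poissonKernel 0 w • (Real.log ‖· - u‖)) 0 R := by
  have hR : 0 < R := pos_of_mem_ball hw
  rcases eq_or_lt_of_le (mem_closedBall_zero_iff.1 hu) with h | h
  · rw [poissonKernel_eq_re_herglotzRieszKernel, smul_eq_mul]
    exact (circleAverage_re_herglotzRieszKernel_mul_log (by simpa using h) hw).ge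
  · set F : ℂ → ℂ := fun z => ((R : ℂ) ^ 2 - (starRingEnd ℂ) u * z) / R
    have hRC : (R : ℂ) ≠ 0 := by exact_mod_cast hR.ne'
    have hFne : ∀ z ∈ closedBall (0 : ℂ) R, F z ≠ 0 := by
      intro z hz h0
      have hz' := mem_closedBall_zero_iff.1 hz
      have : (R : ℂ) ^ 2 = (starRingEnd ℂ) u * z := by
        have := (div_eq_zero_iff.1 h0).resolve_right hRC
        exact sub_eq_zero.1 this
      have := congrArg norm this
      simp only [norm_pow, norm_mul, RCLike.norm_conj, Complex.norm_real, Real.norm_eq_abs,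
        sq_abs] at this
      nlinarith [norm_nonneg u, norm_nonneg z]
    have hharm : InnerProductSpace.HarmonicOnNhd (fun z => Real.log ‖F z‖) (closedBall 0 R) := by
      intro z hz
      refine AnalyticAt.harmonicAt_log_norm ?_ (hFne z hz)
      fun_prop (disch := assumption)
    have hP := hharm.circleAverage_poissonKernel_smul hw
    have hcongr : circleAverage (poissonKernel 0 w • (Real.log ‖· - u‖)) 0 R =
        circleAverage (poissonKernel 0 w • (fun z => Real.log ‖F z‖)) 0 R := by
      refine circleAverage_congr_sphere fun z hz => ?_
      have hz' : ‖z‖ = R := by simpa [abs_of_pos hR] using hz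
      simp only [Pi.smul_apply', smul_eq_mul, F]
      rw [norm_div, norm_sq_sub_conj_mul_of_norm_eq hR hz', Complex.norm_real, Real.norm_eq_abs,
        abs_of_pos hR, mul_div_cancel_left₀ _ hR.ne']
    rw [hcongr, hP]
    refine Real.log_le_log (norm_pos_iff.2 (sub_ne_zero.2 huw)) ?_
    simp only [F]
    rw [norm_div, Complex.norm_real, Real.norm_eq_abs, abs_of_pos hR, le_div_iff₀ hR, mul_comm]
    exact mul_norm_sub_le_norm_sq_sub_conj_mul hR h.le (mem_ball_zero_iff.1 hw).le

lemma continuousOn_poissonKernel_sphere {R : ℝ} {w : ℂ} (hw : w ∈ ball (0 : ℂ) R) :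
    ContinuousOn (poissonKernel 0 w) (sphere 0 |R|) := by
  rw [poissonKernel_eq_re_herglotzRieszKernel]
  exact Complex.continuous_re.comp_continuousOn (continuousOn_herglotzRieszKernel_sphere hw)

/-- **Poisson–Jensen inequality**: `log ‖G‖` is dominated by its Poisson integral. -/
theorem log_norm_le_circleAverage_poissonKernel {G : ℂ → ℂ} {R : ℝ} {w : ℂ}
    (hG : AnalyticOnNhd ℂ G (closedBall 0 R)) (hw : w ∈ ball 0 R) (hGw : G w ≠ 0) :
    Real.log ‖G w‖ ≤ circleAverage (poissonKernel 0 w • (Real.log ‖G ·‖)) 0 R := by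
  have hR : 0 < R := pos_of_mem_ball hw
  have hwc : w ∈ closedBall (0 : ℂ) R := ball_subset_closedBall hw
  have hm := hG.meromorphicOn
  have hsub : sphere (0 : ℂ) |R| ⊆ closedBall 0 R := by
    rw [abs_of_pos hR]; exact sphere_subset_closedBall
  have hord : ∀ u : closedBall (0 : ℂ) R, meromorphicOrderAt G u ≠ ⊤ := by
    rw [← hm.exists_meromorphicOrderAt_ne_top_iff_forall
      ⟨⟨w, hwc⟩, (convex_closedBall 0 R).isPreconnected⟩]
    refine ⟨⟨w, hwc⟩, ?_⟩
    rw [(hG w hwc).meromorphicOrderAt_eq, (hG w hwc).analyticOrderAt_eq_zero.2 hGw]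
    simp
  set D := MeromorphicOn.divisor G (closedBall 0 R) with hD
  have hfin : D.support.Finite := D.finiteSupport (isCompact_closedBall 0 R)
  obtain ⟨g, hg, hgne, hgeq⟩ := hm.extract_zeros_poles hord hfin
  have hlog := MeromorphicOn.extract_zeros_poles_log hgne hgeq
  have hsum : (∑ᶠ u, (D u * Real.log ‖· - u‖) : ℂ → ℝ)
      = ∑ u ∈ hfin.toFinset, fun z => (D u : ℝ) * Real.log ‖z - u‖ := by
    rw [finsum_eq_sum_of_support_subset]
    intro u
    contrapose
    aesop
  have hIlog (u : ℂ) : CircleIntegrable (poissonKernel 0 w • (Real.log ‖· - u‖)) 0 R :=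
    (circleIntegrable_log_norm_sub_const R).continuousOn_smul (continuousOn_poissonKernel_sphere hw)
  have hIg : CircleIntegrable (poissonKernel 0 w • (Real.log ‖g ·‖)) 0 R :=
    CircleIntegrable.continuousOn_smul
      ((hg.mono hsub).meromorphicOn.circleIntegrable_log_norm) (continuousOn_poissonKernel_sphere hw)
  have hav : circleAverage (poissonKernel 0 w • (Real.log ‖G ·‖)) 0 R =
      ∑ u ∈ hfin.toFinset,
        (D u : ℝ) * circleAverage (poissonKernel 0 w • (Real.log ‖· - u‖)) 0 R
        + Real.log ‖g w‖ := by
    have h1 : circleAverage (poissonKernel 0 w • (Real.log ‖G ·‖)) 0 R =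
        circleAverage (∑ u ∈ hfin.toFinset,
          (D u : ℝ) • (poissonKernel 0 w • (Real.log ‖· - u‖))
          + poissonKernel 0 w • (Real.log ‖g ·‖)) 0 R := by
      -- The logarithmic factorisation may fail at the zeros, where `log 0 = 0` by convention; a
      -- discrete exceptional set does not affect the average.
      refine circleAverage_congr_codiscreteWithin ?_ hR.ne'
      have := Filter.codiscreteWithin_mono hsub hlog
      filter_upwards [this] with z hz
      have hz' : Real.log ‖G z‖ = _ := hz
      simp only [Pi.smul_apply', smul_eq_mul, Pi.add_apply, Finset.sum_apply, Pi.smul_apply, hz']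
      rw [hsum]
      simp only [Finset.sum_apply, mul_add, Finset.mul_sum]
      congr 1
      exact Finset.sum_congr rfl fun u _ => by rw [Pi.mul_apply]; ring
    have hI2 : CircleIntegrable (∑ u ∈ hfin.toFinset,
          (D u : ℝ) • (poissonKernel 0 w • (Real.log ‖· - u‖))) 0 R :=
      CircleIntegrable.sum _ fun u _ => (hIlog u).const_smul
    rw [h1, circleAverage_add hI2 hIg, circleAverage_sum fun u _ => (hIlog u).const_smul]
    congr 1
    · exact Finset.sum_congr rfl fun u _ => by rw [circleAverage_smul, smul_eq_mul]
    · exact InnerProductSpace.HarmonicOnNhd.circleAverage_poissonKernel_smul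
        (fun z hz => (hg z hz).harmonicAt_log_norm (hgne ⟨z, hz⟩)) hw
  have hacc : AccPt w (𝓟 (closedBall (0 : ℂ) R)) := by
    apply accPt_iff_frequently_nhdsNE.mpr
    apply compl_notMem
    apply mem_nhdsWithin.mpr
    exact ⟨ball 0 R, isOpen_ball, hw, fun _ h => by simpa using ball_subset_closedBall h.1⟩
  have hval := MeromorphicOn.log_norm_meromorphicTrailingCoeffAt_extract_zeros_poles hfin hwc hacc
    (hm w hwc) (hg w hwc) (hgne ⟨w, hwc⟩) hgeq
  rw [(hG w hwc).meromorphicTrailingCoeffAt_of_ne_zero hGw,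
    finsum_eq_sum_of_support_subset (s := hfin.toFinset) _ (by intro u; aesop)] at hval
  rw [hval, hav]
  -- Termwise comparison is legitimate because the divisor of an analytic function is nonnegative.
  gcongr with u hu
  · have := (MeromorphicOn.AnalyticOnNhd.divisor_nonneg hG) u
    exact_mod_cast this
  · have huD : D u ≠ 0 := by simpa using hu
    refine log_norm_sub_le_circleAverage_poissonKernel (D.supportWithinDomain huD) hw ?_
    rintro rfl
    apply huD
    rw [hD, MeromorphicOn.AnalyticOnNhd.divisor_apply hG hwc, (hG _ hwc).analyticOrderAt_eq_zero.2 hGw]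
    simp

/-! ### Admissible functions and Jensen's formula on circles of radius `r < 1` -/

/-- Analytic functions off `-1`, normalised at `0`, with a first-order bound at `-1` on the closed
unit disc and a lower bound along the radius ending at `-1`. -/
structure IsDiscAdmissible (G : ℂ → ℂ) (K : ℝ) : Prop where
  analytic : AnalyticOnNhd ℂ G {-1}ᶜ
  map_zero : G 0 = 1
  one_le : 1 ≤ K
  bound : ∀ z : ℂ, ‖z‖ ≤ 1 → z ≠ -1 → ‖G z‖ ≤ K / ‖1 + z‖
  lower : ∀ w : ℝ, 0 < w → w < 1 → w ≤ ‖G (-w)‖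

/-- The contribution of `z` to the Blaschke sum of `G`. -/
noncomputable def blaschkeTerm (G : ℂ → ℂ) (z : ℂ) : ℝ :=
  (analyticOrderNatAt G z : ℝ) * -Real.log ‖z‖

lemma blaschkeTerm_nonneg (G : ℂ → ℂ) {z : ℂ} (hz : ‖z‖ ≤ 1) : 0 ≤ blaschkeTerm G z :=
  mul_nonneg (Nat.cast_nonneg _) (neg_nonneg.2 (Real.log_nonpos (norm_nonneg z) hz))

/-- A majorant of `log ‖G‖` along radii. -/
noncomputable def logMajorant (K : ℝ) (θ : ℝ) : ℝ :=
  Real.log (2 * K) - Real.log ‖circleMap 0 1 θ - (-1)‖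

/-- Both `z` and `a` are at distance at least `1 - r` from the circle of radius `r`, and `|z - rz| =
1 - r ≤ |rz - a|`; the triangle inequality through `rz` finishes. -/
lemma norm_sub_le_two_mul_norm_sub {a z : ℂ} (ha : ‖a‖ = 1) (hz : ‖z‖ = 1) {r : ℝ}
    (hr0 : 0 ≤ r) (hr : r ≤ 1) : ‖z - a‖ ≤ 2 * ‖r * z - a‖ := by
  have h1 : ‖z - r * z‖ = 1 - r := by
    rw [← one_sub_mul, norm_mul, hz, mul_one, ← Complex.ofReal_one, ← Complex.ofReal_sub,
      Complex.norm_real, Real.norm_eq_abs, abs_of_nonneg (by linarith)]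
  have h2 : 1 - r ≤ ‖r * z - a‖ := by
    have h3 := norm_sub_norm_le a (r * z)
    rwa [norm_mul, ha, hz, mul_one, Complex.norm_real, Real.norm_eq_abs, norm_sub_rev,
      abs_of_nonneg hr0] at h3
  have h6 : ‖z - a‖ ≤ ‖z - r * z‖ + ‖r * z - a‖ := by
    have := norm_add_le (z - r * z) (r * z - a)
    rwa [sub_add_sub_cancel] at this
  linarith

lemma circleMap_zero_eq_mul (r θ : ℝ) : circleMap 0 r θ = r * circleMap 0 1 θ := by
  simp [circleMap]

lemma norm_circleMap_one (θ : ℝ) : ‖circleMap 0 1 θ‖ = 1 := by simp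

namespace IsDiscAdmissible

variable {G : ℂ → ℂ} {K : ℝ}

lemma analyticOnNhd_closedBall (h : IsDiscAdmissible G K) {r : ℝ} (hr : r < 1) :
    AnalyticOnNhd ℂ G (closedBall 0 r) := by
  refine h.analytic.mono fun z hz hz1 => ?_
  rw [mem_singleton_iff] at hz1
  rw [hz1, mem_closedBall_zero_iff] at hz
  simp at hz
  linarith

lemma logMajorant_nonneg (hK : 1 ≤ K) (θ : ℝ) : 0 ≤ logMajorant K θ := by
  have h1 : ‖circleMap 0 1 θ - (-1)‖ ≤ 2 := by
    refine (norm_sub_le _ _).trans ?_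
    rw [norm_circleMap_one]; norm_num
  rcases (norm_nonneg (circleMap 0 1 θ - (-1))).eq_or_lt with h0 | h0
  · rw [logMajorant, ← h0, Real.log_zero, sub_zero]
    exact Real.log_nonneg (by linarith)
  · exact sub_nonneg.2 (Real.log_le_log h0 (by linarith))

/-- Moving from radius `r` to the boundary costs only a factor `2` in the distance to `-1`, hence a
majorant independent of `r`. -/
lemma log_norm_le_logMajorant (h : IsDiscAdmissible G K) {r θ : ℝ} (hr0 : 0 ≤ r) (hr : r ≤ 1)
    (hθ : circleMap 0 1 θ ≠ -1) : Real.log ‖G (circleMap 0 r θ)‖ ≤ logMajorant K θ := by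
  have hK := h.one_le
  rcases (norm_nonneg (G (circleMap 0 r θ))).eq_or_lt with h0 | h0
  · rw [← h0, Real.log_zero]; exact logMajorant_nonneg hK θ
  have h1 := norm_sub_le_two_mul_norm_sub (a := -1) (by simp) (norm_circleMap_one θ) hr0 hr
  rw [← circleMap_zero_eq_mul] at h1
  have h2 : 0 < ‖circleMap 0 1 θ - (-1)‖ := norm_pos_iff.2 (sub_ne_zero.2 hθ)
  have h3 : 0 < ‖circleMap 0 r θ - (-1)‖ := by linarith
  have h4 := h.bound (circleMap 0 r θ) (by simpa [abs_of_nonneg hr0] using hr)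
    (sub_ne_zero.1 (norm_pos_iff.1 h3))
  rw [logMajorant, ← Real.log_div (by positivity) h2.ne']
  refine Real.log_le_log h0 (h4.trans ?_)
  have h5 : 1 + circleMap 0 r θ = circleMap 0 r θ - (-1) := by ring
  rw [h5]
  rw [div_le_div_iff₀ h3 h2]
  nlinarith

/-- The zeros are isolated, since `G 0 = 1` and the punctured plane is connected. Countability makes
boundary zeros negligible in the integrals over `θ`. -/
lemma countable_zeros (h : IsDiscAdmissible G K) : {z : ℂ | z ≠ -1 ∧ G z = 0}.Countable := by
  have hpre : IsPreconnected ({-1}ᶜ : Set ℂ) :=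
    (isConnected_compl_singleton_of_one_lt_rank (by simp [Complex.rank_real_complex]) _).isPreconnected
  have : DiscreteTopology {z : ℂ | z ≠ -1 ∧ G z = 0} := by
    rw [discreteTopology_subtype_iff]
    intro x hx
    rcases (h.analytic x hx.1).eventually_eq_zero_or_eventually_ne_zero with h1 | h1
    · exfalso
      have := h.analytic.eqOn_zero_of_preconnected_of_eventuallyEq_zero hpre hx.1 h1
        (show (0 : ℂ) ∈ ({-1}ᶜ : Set ℂ) by simp)
      rw [h.map_zero] at this
      simp at this
    · rw [← Filter.empty_mem_iff_bot, Filter.mem_inf_principal]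
      filter_upwards [h1] with z hz hz'
      exact hz hz'.2
  exact (TopologicalSpace.separableSpace_iff_countable (α := {z : ℂ | z ≠ -1 ∧ G z = 0})).1
    inferInstance

lemma ae_ne_zero (h : IsDiscAdmissible G K) :
    ∀ᵐ θ : ℝ, circleMap 0 1 θ ≠ -1 ∧ G (circleMap 0 1 θ) ≠ 0 := by
  have hc : ({z : ℂ | z ≠ -1 ∧ G z = 0} ∪ {-1}).Countable :=
    h.countable_zeros.union (countable_singleton _)
  have := (hc.preimage_circleMap 0 one_ne_zero).ae_notMem volume
  filter_upwards [this] with θ hθ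
  simp only [mem_preimage, mem_union, mem_ofPred_eq, mem_singleton_iff, not_or, not_and] at hθ
  exact ⟨hθ.2, hθ.1 hθ.2⟩

lemma circleIntegrable_log_norm (h : IsDiscAdmissible G K) {r : ℝ} (hr0 : 0 ≤ r) (hr : r < 1) :
    CircleIntegrable (Real.log ‖G ·‖) 0 r := by
  refine MeromorphicOn.circleIntegrable_log_norm ((h.analyticOnNhd_closedBall hr).mono ?_).meromorphicOn
  rw [abs_of_nonneg hr0]; exact sphere_subset_closedBall

lemma analyticOrderAt_ne_top (h : IsDiscAdmissible G K) {z : ℂ} (hz : z ≠ -1) :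
    analyticOrderAt G z ≠ ⊤ := by
  have hpre : IsPreconnected ({-1}ᶜ : Set ℂ) :=
    (isConnected_compl_singleton_of_one_lt_rank (by simp [Complex.rank_real_complex]) _).isPreconnected
  intro h1
  have := h.analytic.eqOn_zero_of_preconnected_of_eventuallyEq_zero hpre hz
    (analyticOrderAt_eq_top.1 h1) (show (0 : ℂ) ∈ ({-1}ᶜ : Set ℂ) by simp)
  rw [h.map_zero] at this
  simp at this

lemma divisor_apply (h : IsDiscAdmissible G K) {r : ℝ} (hr : r < 1) {z : ℂ}
    (hz : z ∈ closedBall 0 r) :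
    MeromorphicOn.divisor G (closedBall 0 r) z = analyticOrderNatAt G z := by
  rw [MeromorphicOn.AnalyticOnNhd.divisor_apply (h.analyticOnNhd_closedBall hr) hz]
  have hz1 : z ≠ -1 := by
    rintro rfl
    simp at hz; linarith
  rw [← ENat.natCast_toNat (h.analyticOrderAt_ne_top hz1)]
  simp [analyticOrderNatAt]

/-- Jensen's formula with the divisor rewritten through analytic orders on a finite set. The term
`log ‖G 0‖` vanishes, and a possible `z = 0` is harmless because `log (r * 0⁻¹) = 0`. -/
lemma exists_circleAverage_eq (h : IsDiscAdmissible G K) {r : ℝ} (hr0 : 0 < r) (hr : r < 1) :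
    ∃ F : Finset ℂ, (∀ z ∈ F, ‖z‖ ≤ r) ∧ (∀ z, ‖z‖ ≤ r → z ∉ F → analyticOrderNatAt G z = 0) ∧
      circleAverage (Real.log ‖G ·‖) 0 r
        = ∑ z ∈ F, (analyticOrderNatAt G z : ℝ) * Real.log (r * ‖z‖⁻¹) := by
  have hA := h.analyticOnNhd_closedBall hr
  have hfin := (MeromorphicOn.divisor G (closedBall 0 r)).finiteSupport (isCompact_closedBall 0 r)
  have hmem : ∀ z ∈ hfin.toFinset, z ∈ closedBall (0 : ℂ) r := fun z hz =>
    (MeromorphicOn.divisor G (closedBall 0 r)).supportWithinDomain (by simpa using hz)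
  refine ⟨hfin.toFinset, fun z hz => by simpa using hmem z hz, fun z hz hzF => ?_, ?_⟩
  · have h1 := h.divisor_apply hr (z := z) (by simpa using hz)
    simp only [Finite.mem_toFinset, Function.mem_support, not_not] at hzF
    rw [hzF] at h1
    exact_mod_cast h1.symm
  · have := AnalyticOnNhd.circleAverage_log_norm hr0.ne' (f := G) (c := 0)
      (by rwa [abs_of_pos hr0]) (by rw [h.map_zero]; exact one_ne_zero)
    rw [this, abs_of_pos hr0, finsum_eq_sum_of_support_subset (s := hfin.toFinset) _
      (by intro u; aesop), h.map_zero]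
    simp only [norm_one, Real.log_one, add_zero, zero_sub, norm_neg]
    refine Finset.sum_congr rfl fun z hz => ?_
    rw [h.divisor_apply hr (hmem z hz)]
    simp

lemma log_mul_inv_nonneg {r : ℝ} {z : ℂ} (hz : ‖z‖ ≤ r) :
    0 ≤ Real.log (r * ‖z‖⁻¹) := by
  rcases (norm_nonneg z).eq_or_lt with h0 | h0
  · simp [← h0]
  · refine Real.log_nonneg ?_
    rw [← div_eq_mul_inv, one_le_div h0]; exact hz

/-- Jensen's formula bounds finite partial sums over zeros. -/
lemma sum_le_circleAverage (h : IsDiscAdmissible G K) {r : ℝ} (hr0 : 0 < r) (hr : r < 1)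
    (F : Finset ℂ) (hF : ∀ z ∈ F, ‖z‖ ≤ r) :
    ∑ z ∈ F, (analyticOrderNatAt G z : ℝ) * Real.log (r * ‖z‖⁻¹)
      ≤ circleAverage (Real.log ‖G ·‖) 0 r := by
  classical
  obtain ⟨F', h1, h2, h3⟩ := h.exists_circleAverage_eq hr0 hr
  rw [h3]
  have h4 : ∑ z ∈ F, (analyticOrderNatAt G z : ℝ) * Real.log (r * ‖z‖⁻¹)
      = ∑ z ∈ F with z ∈ F', (analyticOrderNatAt G z : ℝ) * Real.log (r * ‖z‖⁻¹) := by
    refine (Finset.sum_filter_of_ne fun z hz hne => ?_).symm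
    by_contra hzF
    rw [h2 z (hF z hz) hzF] at hne
    simp at hne
  rw [h4]
  refine Finset.sum_le_sum_of_subset_of_nonneg (fun z hz => (Finset.mem_filter.1 hz).2) ?_
  exact fun z hz _ => mul_nonneg (Nat.cast_nonneg _) (log_mul_inv_nonneg (h1 z hz))

lemma circleAverage_nonneg (h : IsDiscAdmissible G K) {r : ℝ} (hr0 : 0 < r) (hr : r < 1) :
    0 ≤ circleAverage (Real.log ‖G ·‖) 0 r := by
  simpa using h.sum_le_circleAverage hr0 hr ∅ (by simp)

/-- Jensen's formula bounds circle averages by the full Blaschke sum. -/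
lemma circleAverage_le_of_hasSum (h : IsDiscAdmissible G K) {r : ℝ} (hr0 : 0 < r) (hr : r < 1)
    {S : ℝ} (hS : HasSum (fun z : ball (0 : ℂ) 1 => blaschkeTerm G z) S) :
    circleAverage (Real.log ‖G ·‖) 0 r ≤ S := by
  classical
  obtain ⟨F', h1, h2, h3⟩ := h.exists_circleAverage_eq hr0 hr
  have hb : ∀ z ∈ F', z ∈ ball (0 : ℂ) 1 := fun z hz => by simpa using (h1 z hz).trans_lt hr
  calc circleAverage (Real.log ‖G ·‖) 0 r
      = ∑ z ∈ F', (analyticOrderNatAt G z : ℝ) * Real.log (r * ‖z‖⁻¹) := h3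
    _ ≤ ∑ z ∈ F', blaschkeTerm G z := by
        refine Finset.sum_le_sum fun z hz => mul_le_mul_of_nonneg_left ?_ (Nat.cast_nonneg _)
        rcases (norm_nonneg z).eq_or_lt with h0 | h0
        · simp [← h0]
        · rw [Real.log_mul hr0.ne' (by positivity), Real.log_inv]
          linarith [Real.log_nonpos hr0.le hr.le]
    _ = ∑ z ∈ F'.subtype (· ∈ ball (0 : ℂ) 1), blaschkeTerm G z :=
        (Finset.sum_subtype_of_mem (fun z => blaschkeTerm G z) hb).symm
    _ ≤ S := sum_le_hasSum _ (fun z _ => blaschkeTerm_nonneg G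
        (mem_ball_zero_iff.1 z.2).le) hS

end IsDiscAdmissible

/-! ### Passage to the unit circle: integrability and "sum ≤ mean" -/

/-- **Fatou's lemma** for Bochner integrals of nonnegative functions converging almost everywhere. -/
lemma integrable_and_integral_le_of_tendsto {α : Type*} [MeasurableSpace α] {μ : Measure α}
    {v : ℕ → α → ℝ} {f : α → ℝ} {B : ℕ → ℝ} {b : ℝ} (hint : ∀ n, Integrable (v n) μ)
    (hnn : ∀ n, 0 ≤ᵐ[μ] v n) (hlim : ∀ᵐ x ∂μ, Tendsto (fun n => v n x) atTop (𝓝 (f x)))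
    (hB : ∀ n, ∫ x, v n x ∂μ ≤ B n) (hb : Tendsto B atTop (𝓝 b)) :
    Integrable f μ ∧ ∫ x, f x ∂μ ≤ b := by
  have hmeas : AEStronglyMeasurable f μ :=
    aestronglyMeasurable_of_tendsto_ae atTop (fun n => (hint n).aestronglyMeasurable) hlim
  have hf : 0 ≤ᵐ[μ] f := by
    filter_upwards [hlim, ae_all_iff.2 hnn] with x hx hx'
    exact ge_of_tendsto' hx hx'
  have hb0 : 0 ≤ b := ge_of_tendsto' hb fun n => (integral_nonneg_of_ae (hnn n)).trans (hB n)
  have key : ∫⁻ x, ENNReal.ofReal (f x) ∂μ ≤ ENNReal.ofReal b := by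
    calc ∫⁻ x, ENNReal.ofReal (f x) ∂μ
        = ∫⁻ x, liminf (fun n => ENNReal.ofReal (v n x)) atTop ∂μ := by
          refine lintegral_congr_ae ?_
          filter_upwards [hlim] with x hx
          exact (ENNReal.tendsto_ofReal hx).liminf_eq.symm
      _ ≤ liminf (fun n => ∫⁻ x, ENNReal.ofReal (v n x) ∂μ) atTop :=
          lintegral_liminf_le' fun n => (hint n).aestronglyMeasurable.aemeasurable.ennreal_ofReal
      _ ≤ liminf (fun n => ENNReal.ofReal (B n)) atTop := by
          refine liminf_le_liminf (Eventually.of_forall fun n => ?_)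
          rw [← ofReal_integral_eq_lintegral_ofReal (hint n) (hnn n)]
          exact ENNReal.ofReal_le_ofReal (hB n)
      _ = ENNReal.ofReal b := (ENNReal.tendsto_ofReal hb).liminf_eq
  have hI : Integrable f μ := by
    refine ⟨hmeas, ?_⟩
    rw [hasFiniteIntegral_iff_ofReal hf]
    exact key.trans_lt ENNReal.ofReal_lt_top
  refine ⟨hI, ?_⟩
  rw [← ofReal_integral_eq_lintegral_ofReal hI hf] at key
  exact (ENNReal.ofReal_le_ofReal_iff hb0).1 key

/-- Radii increasing to `1`. -/
noncomputable def radiusSeq (n : ℕ) : ℝ := 1 - 1 / ((n : ℝ) + 2)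

lemma radiusSeq_pos (n : ℕ) : 0 < radiusSeq n := by
  rw [radiusSeq, sub_pos, div_lt_one (by positivity)]
  have : (0 : ℝ) ≤ n := Nat.cast_nonneg n
  linarith

lemma radiusSeq_lt_one (n : ℕ) : radiusSeq n < 1 := by
  have : (0 : ℝ) < 1 / ((n : ℝ) + 2) := by positivity
  rw [radiusSeq]; linarith

lemma tendsto_radiusSeq : Tendsto radiusSeq atTop (𝓝 1) := by
  have h1 : Tendsto (fun n : ℕ => 1 / ((n : ℝ) + 2)) atTop (𝓝 0) := by
    refine tendsto_const_nhds.div_atTop ?_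
    exact tendsto_atTop_add_const_right _ _ tendsto_natCast_atTop_atTop
  have h2 := (tendsto_const_nhds (x := (1 : ℝ))).sub h1
  rw [sub_zero] at h2
  exact h2

lemma circleAverage_eq_setIntegral (f : ℂ → ℝ) (r : ℝ) :
    circleAverage f 0 r = (2 * π)⁻¹ * ∫ θ in Ioc 0 (2 * π), f (circleMap 0 r θ) := by
  rw [circleAverage_def, intervalIntegral.integral_of_le two_pi_pos.le, smul_eq_mul]

lemma setIntegral_eq_circleAverage (f : ℂ → ℝ) (r : ℝ) :
    ∫ θ in Ioc 0 (2 * π), f (circleMap 0 r θ) = 2 * π * circleAverage f 0 r := by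
  rw [circleAverage_eq_setIntegral, mul_inv_cancel_left₀ two_pi_pos.ne']

lemma CircleIntegrable.integrableOn_Ioc {f : ℂ → ℝ} {r : ℝ} (h : CircleIntegrable f 0 r) :
    IntegrableOn (fun θ => f (circleMap 0 r θ)) (Ioc 0 (2 * π)) :=
  (intervalIntegrable_iff_integrableOn_Ioc_of_le two_pi_pos.le).1 h

lemma integrableOn_logMajorant (K : ℝ) : IntegrableOn (logMajorant K) (Ioc 0 (2 * π)) := by
  have h1 := (circleIntegrable_log_norm_sub_const (a := -1) (c := 0) 1).integrableOn_Ioc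
  exact (integrableOn_const measure_Ioc_lt_top.ne).sub h1

namespace IsDiscAdmissible

variable {G : ℂ → ℂ} {K : ℝ}

lemma continuousAt_radius (h : IsDiscAdmissible G K) {θ : ℝ} (h1 : circleMap 0 1 θ ≠ -1)
    (h2 : G (circleMap 0 1 θ) ≠ 0) :
    ContinuousAt (fun r : ℝ => Real.log ‖G (circleMap 0 r θ)‖) 1 := by
  have hG : ContinuousAt G (circleMap 0 1 θ) := (h.analytic _ h1).continuousAt
  have hc : ContinuousAt (fun r : ℝ => circleMap 0 r θ) 1 := by
    unfold circleMap; fun_prop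
  exact (ContinuousAt.comp (f := fun r : ℝ => circleMap 0 r θ) hG hc).norm.log (by simpa using h2)

lemma tendsto_log_norm_radius (h : IsDiscAdmissible G K) {θ : ℝ} (h1 : circleMap 0 1 θ ≠ -1)
    (h2 : G (circleMap 0 1 θ) ≠ 0) :
    Tendsto (fun n => Real.log ‖G (circleMap 0 (radiusSeq n) θ)‖) atTop
      (𝓝 (Real.log ‖G (circleMap 0 1 θ)‖)) :=
  (h.continuousAt_radius h1 h2).tendsto.comp tendsto_radiusSeq

lemma circleIntegrable_radiusSeq (h : IsDiscAdmissible G K) (n : ℕ) :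
    IntegrableOn (fun θ => Real.log ‖G (circleMap 0 (radiusSeq n) θ)‖) (Ioc 0 (2 * π)) :=
  (h.circleIntegrable_log_norm (radiusSeq_pos n).le (radiusSeq_lt_one n)).integrableOn_Ioc

/-- Fatou's lemma applied to `logMajorant - log|G|`, nonnegative on each circle, carries eventual
lower bounds for the averages to the boundary. The bound `0` gives integrability; partial Jensen
sums give the Blaschke inequality. -/
lemma integrableOn_and_le_circleAverage (h : IsDiscAdmissible G K) {B : ℕ → ℝ} {b : ℝ}
    (hB : ∀ᶠ n in atTop, B n ≤ circleAverage (Real.log ‖G ·‖) 0 (radiusSeq n))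
    (hb : Tendsto B atTop (𝓝 b)) :
    IntegrableOn (fun θ => Real.log ‖G (circleMap 0 1 θ)‖) (Ioc 0 (2 * π)) ∧
      b ≤ circleAverage (Real.log ‖G ·‖) 0 1 := by
  obtain ⟨N, hN⟩ := eventually_atTop.1 hB
  have hM := integrableOn_logMajorant K
  have key := integrable_and_integral_le_of_tendsto (μ := volume.restrict (Ioc 0 (2 * π)))
    (v := fun n θ => logMajorant K θ - Real.log ‖G (circleMap 0 (radiusSeq (n + N)) θ)‖)
    (f := fun θ => logMajorant K θ - Real.log ‖G (circleMap 0 1 θ)‖)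
    (B := fun n => (∫ θ in Ioc 0 (2 * π), logMajorant K θ) - 2 * π * B (n + N))
    (b := (∫ θ in Ioc 0 (2 * π), logMajorant K θ) - 2 * π * b)
    (fun n => hM.sub (h.circleIntegrable_radiusSeq _))
    (fun n => by
      filter_upwards [ae_restrict_of_ae h.ae_ne_zero] with θ hθ
      exact sub_nonneg.2 (h.log_norm_le_logMajorant (radiusSeq_pos _).le (radiusSeq_lt_one _).le
        hθ.1))
    (by
      filter_upwards [ae_restrict_of_ae h.ae_ne_zero] with θ hθ
      exact tendsto_const_nhds.sub
        ((tendsto_add_atTop_iff_nat N).2 (h.tendsto_log_norm_radius hθ.1 hθ.2)))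
    (fun n => by
      rw [integral_sub hM (h.circleIntegrable_radiusSeq _),
        setIntegral_eq_circleAverage (fun z => Real.log ‖G z‖)]
      have := mul_le_mul_of_nonneg_left (hN (n + N) (by omega)) two_pi_pos.le
      linarith)
    (tendsto_const_nhds.sub (((tendsto_add_atTop_iff_nat N).2 hb).const_mul _))
  have hI : IntegrableOn (fun θ => Real.log ‖G (circleMap 0 1 θ)‖) (Ioc 0 (2 * π)) := by
    refine (hM.sub key.1).congr (Eventually.of_forall fun θ => ?_)
    simp
  refine ⟨hI, ?_⟩
  have h1 := key.2
  rw [integral_sub hM hI, setIntegral_eq_circleAverage (fun z => Real.log ‖G z‖)] at h1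
  exact le_of_mul_le_mul_left (by linarith) two_pi_pos

lemma integrableOn_log_norm (h : IsDiscAdmissible G K) :
    IntegrableOn (fun θ => Real.log ‖G (circleMap 0 1 θ)‖) (Ioc 0 (2 * π)) :=
  (h.integrableOn_and_le_circleAverage (B := fun _ => 0) (b := 0)
    (Eventually.of_forall fun n => h.circleAverage_nonneg (radiusSeq_pos n) (radiusSeq_lt_one n))
    tendsto_const_nhds).1

lemma sum_blaschkeTerm_le (h : IsDiscAdmissible G K) (F : Finset (ball (0 : ℂ) 1)) :
    ∑ z ∈ F, blaschkeTerm G z ≤ circleAverage (Real.log ‖G ·‖) 0 1 := by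
  refine (h.integrableOn_and_le_circleAverage (B := fun n => ∑ z ∈ F,
    (analyticOrderNatAt G z : ℝ) * Real.log (radiusSeq n * ‖(z : ℂ)‖⁻¹)) ?_ ?_).2
  · have h1 : ∀ᶠ n in atTop, ∀ z ∈ F, ‖(z : ℂ)‖ ≤ radiusSeq n := by
      rw [Filter.eventually_all_finset]
      intro z _
      exact tendsto_radiusSeq.eventually (eventually_ge_nhds (mem_ball_zero_iff.1 z.2))
    filter_upwards [h1] with n hn
    have := h.sum_le_circleAverage (radiusSeq_pos n) (radiusSeq_lt_one n)
      (F.map (Function.Embedding.subtype _)) (by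
        intro z hz
        obtain ⟨z', hz', rfl⟩ := Finset.mem_map.1 hz
        exact hn z' hz')
    simpa using this
  · refine tendsto_finsetSum _ fun z _ => Tendsto.const_mul _ ?_
    rcases (norm_nonneg (z : ℂ)).eq_or_lt with h0 | h0
    · simp [← h0]
    · have h1 : -Real.log ‖(z : ℂ)‖ = Real.log (1 * ‖(z : ℂ)‖⁻¹) := by rw [one_mul, Real.log_inv]
      rw [h1]
      refine (Real.continuousAt_log (by positivity)).tendsto.comp ?_
      exact tendsto_radiusSeq.mul_const _

lemma summable_blaschkeTerm (h : IsDiscAdmissible G K) :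
    Summable (fun z : ball (0 : ℂ) 1 => blaschkeTerm G z) :=
  summable_of_sum_le (fun z => blaschkeTerm_nonneg G (mem_ball_zero_iff.1 z.2).le)
    h.sum_blaschkeTerm_le

lemma tsum_blaschkeTerm_le (h : IsDiscAdmissible G K) :
    ∑' z : ball (0 : ℂ) 1, blaschkeTerm G z ≤ circleAverage (Real.log ‖G ·‖) 0 1 :=
  h.summable_blaschkeTerm.tsum_le_of_sum_le h.sum_blaschkeTerm_le

end IsDiscAdmissible

/-! ### A kernel vanishing at the singular boundary direction -/

/-- Up to a constant, the difference of the Poisson kernels at `0` and at `-w` on the circle of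
radius `r`, normalised to vanish at `-r`. -/
noncomputable def endpointKernel (r w θ : ℝ) : ℝ :=
  1 - (r - w) ^ 2 / ‖circleMap 0 r θ + w‖ ^ 2

lemma sub_le_norm_circleMap_add {r w : ℝ} (hw : 0 < w) (hwr : w < r) (θ : ℝ) :
    r - w ≤ ‖circleMap 0 r θ + w‖ := by
  have := norm_sub_norm_le (circleMap 0 r θ) (-w : ℂ)
  rw [norm_circleMap_zero, norm_neg, Complex.norm_real, Real.norm_eq_abs, abs_of_pos hw,
    abs_of_pos (hw.trans hwr), sub_neg_eq_add] at this
  exact this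

lemma endpointKernel_nonneg {r w : ℝ} (hw : 0 < w) (hwr : w < r) (θ : ℝ) :
    0 ≤ endpointKernel r w θ := by
  have h1 := sub_le_norm_circleMap_add hw hwr θ
  have h2 : 0 < ‖circleMap 0 r θ + w‖ := by linarith
  rw [endpointKernel, sub_nonneg, div_le_one (by positivity)]
  exact pow_le_pow_left₀ (by linarith) h1 2

lemma endpointKernel_le_one (r w θ : ℝ) : endpointKernel r w θ ≤ 1 := by
  rw [endpointKernel]
  have : 0 ≤ (r - w) ^ 2 / ‖circleMap 0 r θ + w‖ ^ 2 := by positivity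
  linarith

/-- With `N = |re^{iθ} + w|` and `d = |e^{iθ} + 1|`, `N ≤ d + (r - w)` gives `N² - (r - w)² ≤ 4d`,
while `N ≥ r - w ≥ (1 - w)/2`; the quotient gives the constant `16/(1 - w)²`. The bound is uniform
in `r`. -/
lemma endpointKernel_le {r w : ℝ} (hw : 0 < w) (hwr : (1 + w) / 2 ≤ r) (hr : r ≤ 1) (hw1 : w < 1)
    (θ : ℝ) :
    endpointKernel r w θ ≤ 16 / (1 - w) ^ 2 * ‖circleMap 0 1 θ - (-1)‖ := by
  have hr' : (1 - w) / 2 ≤ r - w := by linarith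
  have h0 : 0 < (1 - w) / 2 := by linarith
  have h1 := sub_le_norm_circleMap_add hw (by linarith : w < r) θ
  set d := ‖circleMap 0 1 θ - (-1)‖ with hd
  set N := ‖circleMap 0 r θ + w‖ with hN
  have hd0 : 0 ≤ d := norm_nonneg _
  have hd2 : d ≤ 2 := by
    refine (norm_sub_le _ _).trans ?_
    rw [norm_circleMap_one]; norm_num
  have h2 : N ≤ d + (r - w) := by
    have e : circleMap 0 r θ + w = r * (circleMap 0 1 θ - (-1)) + ((w - r : ℝ) : ℂ) := by
      rw [circleMap_zero_eq_mul]; push_cast; ring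
    rw [hN, e]
    refine (norm_add_le _ _).trans ?_
    rw [norm_mul, Complex.norm_real, Complex.norm_real, Real.norm_eq_abs, Real.norm_eq_abs,
      abs_of_pos (by linarith : 0 < r), abs_sub_comm, abs_of_pos (by linarith : 0 < r - w), ← hd]
    nlinarith
  have hNpos : 0 < N := by linarith
  rw [endpointKernel, ← hN, one_sub_div (by positivity), div_le_iff₀ (by positivity)]
  have h3 : (1 - w) ^ 2 / 4 ≤ N ^ 2 := by nlinarith
  have h4 : N ^ 2 - (r - w) ^ 2 ≤ 4 * d := by
    have : N ^ 2 ≤ (d + (r - w)) ^ 2 := pow_le_pow_left₀ hNpos.le h2 2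
    nlinarith
  have h5 : 16 / (1 - w) ^ 2 * d * ((1 - w) ^ 2 / 4) = 4 * d := by
    field_simp [(by linarith : 1 - w ≠ 0)]
    ring
  have h6 : 0 ≤ 16 / (1 - w) ^ 2 * d := by positivity
  calc N ^ 2 - (r - w) ^ 2 ≤ 4 * d := h4
    _ = 16 / (1 - w) ^ 2 * d * ((1 - w) ^ 2 / 4) := h5.symm
    _ ≤ 16 / (1 - w) ^ 2 * d * N ^ 2 := mul_le_mul_of_nonneg_left h3 h6

lemma continuous_endpointKernel {r w : ℝ} (hw : 0 < w) (hwr : w < r) :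
    Continuous (endpointKernel r w) := by
  unfold endpointKernel
  refine continuous_const.sub (continuous_const.div ?_ fun θ => ?_)
  · have := continuous_circleMap 0 r
    fun_prop
  · have := sub_le_norm_circleMap_add hw hwr θ
    have : 0 < ‖circleMap 0 r θ + w‖ := by linarith
    positivity

lemma continuousAt_endpointKernel_radius {w : ℝ} (hw : 0 < w) (hw1 : w < 1) (θ : ℝ) :
    ContinuousAt (fun r => endpointKernel r w θ) 1 := by
  unfold endpointKernel
  have h1 := sub_le_norm_circleMap_add hw hw1 θ
  have h2 : ‖circleMap 0 1 θ + w‖ ^ 2 ≠ 0 := by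
    have : 0 < ‖circleMap 0 1 θ + w‖ := by linarith
    positivity
  have hc : ContinuousAt (fun r : ℝ => circleMap 0 r θ) 1 := by
    unfold circleMap; fun_prop
  fun_prop (disch := exact h2)

lemma tendsto_endpointKernel_one {θ : ℝ} (hθ : circleMap 0 1 θ ≠ -1) :
    Tendsto (fun w => endpointKernel 1 w θ) (𝓝 1) (𝓝 1) := by
  have h2 : ‖circleMap 0 1 θ + ((1 : ℝ) : ℂ)‖ ^ 2 ≠ 0 := by
    have : circleMap 0 1 θ + ((1 : ℝ) : ℂ) ≠ 0 := fun h => hθ (by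
      rw [eq_neg_iff_add_eq_zero]; simpa using h)
    have := norm_pos_iff.2 this
    positivity
  have hc : ContinuousAt (fun w => endpointKernel 1 w θ) 1 := by
    unfold endpointKernel
    fun_prop (disch := exact h2)
  have := hc.tendsto
  simpa [endpointKernel] using this

namespace IsDiscAdmissible

variable {G : ℂ → ℂ} {K : ℝ}

lemma integrableOn_mul_endpointKernel {f : ℝ → ℝ} (hf : IntegrableOn f (Ioc 0 (2 * π))) {r w : ℝ}
    (hw : 0 < w) (hwr : w < r) :
    IntegrableOn (fun θ => f θ * endpointKernel r w θ) (Ioc 0 (2 * π)) := by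
  refine Integrable.mul_bdd (c := 1) hf (continuous_endpointKernel hw hwr).aestronglyMeasurable ?_
  refine Eventually.of_forall fun θ => ?_
  rw [Real.norm_eq_abs, abs_of_nonneg (endpointKernel_nonneg hw hwr θ)]
  exact endpointKernel_le_one _ _ _

/-- The kernel is `1 - (r - w)/(r + w) · P`, with `P` the Poisson kernel at `-w`. Jensen bounds the
mean against `1` by `S`, and Poisson–Jensen bounds the mean against `P` below by `log|G(-w)| ≥ log
w`. -/
lemma setIntegral_mul_endpointKernel_le (h : IsDiscAdmissible G K) {r w S : ℝ}
    (hw : 0 < w) (hwr : w < r) (hr : r < 1)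
    (hS : HasSum (fun z : ball (0 : ℂ) 1 => blaschkeTerm G z) S) :
    ∫ θ in Ioc 0 (2 * π), Real.log ‖G (circleMap 0 r θ)‖ * endpointKernel r w θ
      ≤ 2 * π * (S - (r - w) / (r + w) * Real.log w) := by
  have hr0 : 0 < r := hw.trans hwr
  have hwb : (-w : ℂ) ∈ ball (0 : ℂ) r := by
    simpa [abs_of_pos hw] using hwr
  have hlow := h.lower w hw (hwr.trans hr)
  have hGw : G (-w) ≠ 0 := norm_pos_iff.1 (hw.trans_le hlow)
  have h1 := log_norm_le_circleAverage_poissonKernel (h.analyticOnNhd_closedBall hr) hwb hGw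
  have h2 := h.circleAverage_le_of_hasSum hr0 hr hS
  have h3 : Real.log w ≤ Real.log ‖G (-w)‖ := Real.log_le_log hw hlow
  have hI := (h.circleIntegrable_log_norm hr0.le hr)
  have hIP : CircleIntegrable (poissonKernel 0 (-w) • (Real.log ‖G ·‖)) 0 r :=
    CircleIntegrable.continuousOn_smul hI (continuousOn_poissonKernel_sphere hwb)
  have e : ∀ θ, Real.log ‖G (circleMap 0 r θ)‖ * endpointKernel r w θ =
      Real.log ‖G (circleMap 0 r θ)‖ - (r - w) / (r + w) *
        (poissonKernel 0 (-w) • (Real.log ‖G ·‖)) (circleMap 0 r θ) := by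
    intro θ
    simp only [Pi.smul_apply', smul_eq_mul, poissonKernel, endpointKernel, sub_zero,
      sub_neg_eq_add, norm_circleMap_zero, norm_neg, Complex.norm_real, Real.norm_eq_abs, sq_abs]
    have h4 := sub_le_norm_circleMap_add hw hwr θ
    have h5 : 0 < ‖circleMap 0 r θ + w‖ := by linarith
    have h6 : r + w ≠ 0 := by positivity
    field_simp
    ring
  simp_rw [e]
  rw [integral_sub hI.integrableOn_Ioc (hIP.integrableOn_Ioc.const_mul _), integral_const_mul,
    setIntegral_eq_circleAverage (fun z => Real.log ‖G z‖), setIntegral_eq_circleAverage]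
  have h7 : 0 ≤ (r - w) / (r + w) := div_nonneg (by linarith) (by linarith)
  have h8 := mul_le_mul_of_nonneg_left (h3.trans h1) h7
  have h9 := mul_le_mul_of_nonneg_left (sub_le_sub h2 h8) two_pi_pos.le
  linarith

end IsDiscAdmissible

/-! ### Control away from `-1` and "mean ≤ sum" -/

/-- Near a boundary point, an analytic function on a smaller concentric circle is bounded below by
a multiple of its value on the unit circle. -/
lemma AnalyticAt.exists_mul_norm_le_norm_radial {G : ℂ → ℂ} {a : ℂ} (ha : ‖a‖ = 1)
    (hG : AnalyticAt ℂ G a) (hord : analyticOrderAt G a ≠ ⊤) :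
    ∃ c > 0, ∃ U ∈ 𝓝 a, ∀ᶠ r : ℝ in 𝓝[<] 1, ∀ z ∈ U, ‖z‖ = 1 → c * ‖G z‖ ≤ ‖G (r * z)‖ := by
  obtain ⟨g, hg, hga, hgeq⟩ := (hG.analyticOrderAt_ne_top).1 hord
  set m := analyticOrderNatAt G a
  set k := ‖g a‖ with hk
  have hk0 : 0 < k := norm_pos_iff.2 hga
  have hgn : Tendsto (fun z => ‖g z‖) (𝓝 a) (𝓝 k) := hg.continuousAt.norm
  have hev : ∀ᶠ z in 𝓝 a, G z = (z - a) ^ m • g z ∧ k / 2 < ‖g z‖ ∧ ‖g z‖ < 2 * k :=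
    hgeq.and ((hgn.eventually (lt_mem_nhds (by linarith))).and
      (hgn.eventually (gt_mem_nhds (by linarith))))
  have hmul : Tendsto (fun p : ℂ × ℝ => (p.2 : ℂ) * p.1) (𝓝 a ×ˢ 𝓝[<] 1) (𝓝 a) := by
    have hc : Continuous (fun p : ℂ × ℝ => (p.2 : ℂ) * p.1) := by fun_prop
    have := hc.tendsto (a, (1 : ℝ))
    rw [nhds_prod_eq] at this
    simp only [Complex.ofReal_one, one_mul] at this
    exact this.mono_left (Filter.prod_mono le_rfl nhdsWithin_le_nhds)
  have h2 := hmul.eventually hev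
  rw [Filter.eventually_iff_exists_mem] at h2
  obtain ⟨V, hV, hV'⟩ := h2
  obtain ⟨U, hU, R, hR, hUR⟩ := Filter.mem_prod_iff.1 hV
  -- The factor `(1/2)^m` comes from `|z - a| ≤ 2|rz - a|`, the factor `1/4` from `k/2 < |g| < 2k`
  -- near `a`.
  refine ⟨(1 / 2) ^ m / 4, by positivity, U ∩ {z | G z = (z - a) ^ m • g z ∧ k / 2 < ‖g z‖ ∧
    ‖g z‖ < 2 * k}, inter_mem hU hev, ?_⟩
  have hr01 : ∀ᶠ r : ℝ in 𝓝[<] 1, 0 ≤ r ∧ r ≤ 1 := by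
    refine Filter.Eventually.and ?_ ?_
    · exact nhdsWithin_le_nhds (Ici_mem_nhds zero_lt_one)
    · filter_upwards [self_mem_nhdsWithin] with r hr using le_of_lt hr
  filter_upwards [hR, hr01] with r hr hr01 z hz hz1
  obtain ⟨e1, l1, -⟩ := hV' (z, r) (hUR ⟨hz.1, hr⟩)
  obtain ⟨e2, -, l2⟩ := hz.2
  simp only at e1 l1
  have hd := norm_sub_le_two_mul_norm_sub ha hz1 hr01.1 hr01.2
  rw [e1, e2, norm_smul, norm_smul, norm_pow, norm_pow]
  have h3 : (1 / 2) ^ m * ‖z - a‖ ^ m ≤ ‖(r : ℂ) * z - a‖ ^ m := by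
    rw [← mul_pow]
    exact pow_le_pow_left₀ (by positivity) (by linarith) m
  calc (1 / 2) ^ m / 4 * (‖z - a‖ ^ m * ‖g z‖)
      = ((1 / 2) ^ m * ‖z - a‖ ^ m) * (‖g z‖ / 4) := by ring
    _ ≤ ‖(r : ℂ) * z - a‖ ^ m * ‖g (r * z)‖ :=
        mul_le_mul h3 (by linarith) (by positivity) (by positivity)

namespace IsDiscAdmissible

variable {G : ℂ → ℂ} {K : ℝ}

/-- Compactness of the arc makes the local radial bound uniform, even through boundary zeros of `G`;
it supplies the domination for `r → 1`. -/
lemma exists_mul_norm_le_norm_radial (h : IsDiscAdmissible G K) {δ : ℝ} (hδ : 0 < δ) :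
    ∃ c > 0, ∀ᶠ r : ℝ in 𝓝[<] 1, ∀ z : ℂ, ‖z‖ = 1 → δ ≤ ‖z - (-1)‖ →
      c * ‖G z‖ ≤ ‖G (r * z)‖ := by
  set A : Set ℂ := {z | ‖z‖ = 1 ∧ δ ≤ ‖z - (-1)‖} with hA
  have hcomp : IsCompact A := by
    have : A = sphere 0 1 ∩ {z | δ ≤ ‖z - (-1)‖} := by ext z; simp [hA]
    rw [this]
    exact (isCompact_sphere 0 1).inter_right (isClosed_le continuous_const (by fun_prop))
  have := hcomp.induction_on
    (p := fun s => ∃ c > 0, ∀ᶠ r : ℝ in 𝓝[<] 1, ∀ z ∈ s, ‖z‖ = 1 → c * ‖G z‖ ≤ ‖G (r * z)‖)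
    ⟨1, one_pos, by simp⟩
    (fun s t hst ⟨c, hc, ht⟩ => ⟨c, hc, ht.mono fun r hr z hz => hr z (hst hz)⟩)
    (fun s t ⟨c, hc, hs⟩ ⟨c', hc', ht⟩ => by
      refine ⟨min c c', lt_min hc hc', ?_⟩
      filter_upwards [hs, ht] with r h1 h2 z hz hz1
      rcases hz with hz | hz
      · exact (mul_le_mul_of_nonneg_right (min_le_left _ _) (norm_nonneg _)).trans (h1 z hz hz1)
      · exact (mul_le_mul_of_nonneg_right (min_le_right _ _) (norm_nonneg _)).trans (h2 z hz hz1))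
    (fun a ha => by
      have ha1 : a ≠ -1 := by
        rintro rfl
        have := ha.2
        simp at this
        linarith
      obtain ⟨c, hc, U, hU, hr⟩ := (h.analytic a ha1).exists_mul_norm_le_norm_radial ha.1
        (h.analyticOrderAt_ne_top ha1)
      exact ⟨U, mem_nhdsWithin_of_mem_nhds hU, c, hc, hr⟩)
  obtain ⟨c, hc, hr⟩ := this
  exact ⟨c, hc, hr.mono fun r h1 z hz hz' => h1 z ⟨hz, hz'⟩ hz⟩

/-- Convergence of weighted integrals over arcs that avoid `-1`. -/
lemma tendsto_setIntegral_arc (h : IsDiscAdmissible G K) {w δ : ℝ} (hw : 0 < w) (hw1 : w < 1)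
    (hδ : 0 < δ) :
    Tendsto (fun n => ∫ θ in Ioc 0 (2 * π) ∩ {θ | δ ≤ ‖circleMap 0 1 θ - (-1)‖},
      (logMajorant K θ - Real.log ‖G (circleMap 0 (radiusSeq n) θ)‖)
        * endpointKernel (radiusSeq n) w θ) atTop
      (𝓝 (∫ θ in Ioc 0 (2 * π) ∩ {θ | δ ≤ ‖circleMap 0 1 θ - (-1)‖},
        (logMajorant K θ - Real.log ‖G (circleMap 0 1 θ)‖) * endpointKernel 1 w θ)) := by
  obtain ⟨c, hc, hcr⟩ := h.exists_mul_norm_le_norm_radial hδ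
  have hseq : Tendsto radiusSeq atTop (𝓝[<] 1) :=
    tendsto_nhdsWithin_iff.2 ⟨tendsto_radiusSeq, Eventually.of_forall radiusSeq_lt_one⟩
  have hwr : ∀ᶠ n in atTop, w < radiusSeq n :=
    tendsto_radiusSeq.eventually (lt_mem_nhds hw1)
  have hMeas : MeasurableSet {θ : ℝ | δ ≤ ‖circleMap 0 1 θ - (-1)‖} := by
    have := continuous_circleMap 0 1
    exact (isClosed_le continuous_const (by fun_prop)).measurableSet
  have hM := integrableOn_logMajorant K
  refine tendsto_integral_filter_of_dominated_convergence
    -- From `c |G(z)| ≤ |G(rz)|`: passing to radius `r` lowers `log|G|` by at most `|log c|`.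
    (fun θ => (logMajorant K θ - Real.log ‖G (circleMap 0 1 θ)‖) + |Real.log c|) ?_ ?_ ?_ ?_
  · filter_upwards [hwr] with n hn
    exact ((integrableOn_mul_endpointKernel (hM.sub (h.circleIntegrable_radiusSeq n)) hw
      hn).mono_set inter_subset_left).aestronglyMeasurable
  · filter_upwards [hwr, hseq.eventually hcr] with n hn hcn
    rw [ae_restrict_iff' (measurableSet_Ioc.inter hMeas)]
    filter_upwards [h.ae_ne_zero] with θ hθ hθδ
    have h1 := h.log_norm_le_logMajorant (radiusSeq_pos n).le (radiusSeq_lt_one n).le hθ.1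
    have h2 := hcn (circleMap 0 1 θ) (norm_circleMap_one θ) hθδ.2
    rw [← circleMap_zero_eq_mul] at h2
    have h3 : 0 < ‖G (circleMap 0 1 θ)‖ := norm_pos_iff.2 hθ.2
    have h4 := Real.log_le_log (by positivity) h2
    rw [Real.log_mul hc.ne' h3.ne'] at h4
    have h5 := neg_abs_le (Real.log c)
    have h6 := endpointKernel_nonneg hw hn θ
    have h7 := endpointKernel_le_one (radiusSeq n) w θ
    rw [Real.norm_eq_abs, abs_of_nonneg (mul_nonneg (sub_nonneg.2 h1) h6)]
    refine (mul_le_of_le_one_right (sub_nonneg.2 h1) h7).trans ?_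
    linarith
  · refine Integrable.add ((hM.sub h.integrableOn_log_norm).mono_set inter_subset_left) ?_
    exact (integrableOn_const (measure_Ioc_lt_top.ne)).mono_set inter_subset_left
  · refine ae_restrict_of_ae ?_
    filter_upwards [h.ae_ne_zero] with θ hθ
    exact (tendsto_const_nhds.sub (h.tendsto_log_norm_radius hθ.1 hθ.2)).mul
      ((continuousAt_endpointKernel_radius hw hw1 θ).tendsto.comp tendsto_radiusSeq)

/-- Near `-1` the smallness of the kernel replaces domination: an arc of size `δ` contributes at
most `C * δ`, uniformly in `r`. So `r → 1` is taken first, then `δ → 0`. -/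
lemma setIntegral_boundary_mul_endpointKernel_le (h : IsDiscAdmissible G K) {w S : ℝ}
    (hw : 0 < w) (hw1 : w < 1)
    (hS : HasSum (fun z : ball (0 : ℂ) 1 => blaschkeTerm G z) S) :
    ∫ θ in Ioc 0 (2 * π), Real.log ‖G (circleMap 0 1 θ)‖ * endpointKernel 1 w θ
      ≤ 2 * π * (S - (1 - w) / (1 + w) * Real.log w) := by
  have hM := integrableOn_logMajorant K
  have hU := h.integrableOn_log_norm
  set C : ℝ := 16 / (1 - w) ^ 2 * ∫ θ in Ioc 0 (2 * π), logMajorant K θ with hC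
  have hMk : Tendsto (fun n => ∫ θ in Ioc 0 (2 * π),
      logMajorant K θ * endpointKernel (radiusSeq n) w θ) atTop
      (𝓝 (∫ θ in Ioc 0 (2 * π), logMajorant K θ * endpointKernel 1 w θ)) := by
    refine tendsto_integral_filter_of_dominated_convergence (logMajorant K) ?_ ?_ hM ?_
    · filter_upwards [tendsto_radiusSeq.eventually (lt_mem_nhds hw1)] with n hn
      exact (integrableOn_mul_endpointKernel hM hw hn).aestronglyMeasurable
    · filter_upwards [tendsto_radiusSeq.eventually (lt_mem_nhds hw1)] with n hn
      refine Eventually.of_forall fun θ => ?_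
      have h0 := logMajorant_nonneg h.one_le θ
      rw [Real.norm_eq_abs, abs_of_nonneg (mul_nonneg h0 (endpointKernel_nonneg hw hn θ))]
      exact mul_le_of_le_one_right h0 (endpointKernel_le_one _ _ _)
    · exact Eventually.of_forall fun θ => tendsto_const_nhds.mul
        ((continuousAt_endpointKernel_radius hw hw1 θ).tendsto.comp tendsto_radiusSeq)
  have key : ∀ δ > 0, (∫ θ in Ioc 0 (2 * π), logMajorant K θ * endpointKernel 1 w θ)
      - 2 * π * (S - (1 - w) / (1 + w) * Real.log w)
      ≤ (∫ θ in Ioc 0 (2 * π), (logMajorant K θ - Real.log ‖G (circleMap 0 1 θ)‖)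
        * endpointKernel 1 w θ) + C * δ := by
    intro δ hδ
    set E : Set ℝ := {θ | δ ≤ ‖circleMap 0 1 θ - (-1)‖} with hE
    have hEm : MeasurableSet E := by
      have := continuous_circleMap 0 1
      exact (isClosed_le continuous_const (by fun_prop)).measurableSet
    have hlim1 := h.tendsto_setIntegral_arc hw hw1 hδ
    have hlim2 : Tendsto (fun n => (∫ θ in Ioc 0 (2 * π),
        logMajorant K θ * endpointKernel (radiusSeq n) w θ)
        - 2 * π * (S - (radiusSeq n - w) / (radiusSeq n + w) * Real.log w)) atTop
        (𝓝 ((∫ θ in Ioc 0 (2 * π), logMajorant K θ * endpointKernel 1 w θ)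
          - 2 * π * (S - (1 - w) / (1 + w) * Real.log w))) := by
      refine hMk.sub (Tendsto.const_mul _ (tendsto_const_nhds.sub (Tendsto.mul_const _ ?_)))
      exact (tendsto_radiusSeq.sub_const w).div (tendsto_radiusSeq.add_const w) (by linarith)
    have hle : ∀ᶠ n in atTop, (∫ θ in Ioc 0 (2 * π),
        logMajorant K θ * endpointKernel (radiusSeq n) w θ)
        - 2 * π * (S - (radiusSeq n - w) / (radiusSeq n + w) * Real.log w)
        ≤ (∫ θ in Ioc 0 (2 * π) ∩ E,
          (logMajorant K θ - Real.log ‖G (circleMap 0 (radiusSeq n) θ)‖)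
            * endpointKernel (radiusSeq n) w θ) + C * δ := by
      filter_upwards [tendsto_radiusSeq.eventually (lt_mem_nhds hw1),
        tendsto_radiusSeq.eventually (le_mem_nhds (by linarith : (1 + w) / 2 < 1))] with n hn hn'
      have hr1 := radiusSeq_lt_one n
      have hUn := h.circleIntegrable_radiusSeq n
      have hv : IntegrableOn (fun θ => logMajorant K θ
          - Real.log ‖G (circleMap 0 (radiusSeq n) θ)‖) (Ioc 0 (2 * π)) := hM.sub hUn
      have hvδ : IntegrableOn (fun θ => (logMajorant K θ
          - Real.log ‖G (circleMap 0 (radiusSeq n) θ)‖) * (16 / (1 - w) ^ 2 * δ))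
          (Ioc 0 (2 * π)) := hv.mul_const _
      have hvk := integrableOn_mul_endpointKernel hv hw hn
      have h1 := h.setIntegral_mul_endpointKernel_le hw hn hr1 hS
      have h2 : ∫ θ in Ioc 0 (2 * π), (logMajorant K θ - Real.log ‖G (circleMap 0 (radiusSeq n) θ)‖)
          * endpointKernel (radiusSeq n) w θ
          = (∫ θ in Ioc 0 (2 * π), logMajorant K θ * endpointKernel (radiusSeq n) w θ)
          - ∫ θ in Ioc 0 (2 * π), Real.log ‖G (circleMap 0 (radiusSeq n) θ)‖
            * endpointKernel (radiusSeq n) w θ := by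
        simp_rw [sub_mul]
        exact integral_sub (integrableOn_mul_endpointKernel hM hw hn)
          (integrableOn_mul_endpointKernel hUn hw hn)
      have hvnn : ∀ᵐ θ, 0 ≤ logMajorant K θ - Real.log ‖G (circleMap 0 (radiusSeq n) θ)‖ := by
        filter_upwards [h.ae_ne_zero] with θ hθ
        exact sub_nonneg.2 (h.log_norm_le_logMajorant (radiusSeq_pos n).le hr1.le hθ.1)
      have h3 : ∫ θ in Ioc 0 (2 * π) \ E,
          (logMajorant K θ - Real.log ‖G (circleMap 0 (radiusSeq n) θ)‖)
          * endpointKernel (radiusSeq n) w θ ≤ C * δ := by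
        calc _ ≤ ∫ θ in Ioc 0 (2 * π) \ E,
              (logMajorant K θ - Real.log ‖G (circleMap 0 (radiusSeq n) θ)‖)
                * (16 / (1 - w) ^ 2 * δ) := by
              refine setIntegral_mono_on_ae (hvk.mono_set sdiff_subset)
                (hvδ.mono_set sdiff_subset) (measurableSet_Ioc.diff hEm) ?_
              filter_upwards [hvnn] with θ hθ hθE
              refine mul_le_mul_of_nonneg_left ?_ hθ
              refine (endpointKernel_le hw hn' hr1.le hw1 θ).trans ?_
              have : ‖circleMap 0 1 θ - (-1)‖ ≤ δ := (not_le.1 hθE.2).le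
              gcongr
          _ ≤ ∫ θ in Ioc 0 (2 * π),
              (logMajorant K θ - Real.log ‖G (circleMap 0 (radiusSeq n) θ)‖)
                * (16 / (1 - w) ^ 2 * δ) := by
              refine setIntegral_mono_set hvδ ?_ sdiff_subset.eventuallyLE
              filter_upwards [ae_restrict_of_ae hvnn] with θ hθ
              exact mul_nonneg hθ (by positivity)
          _ = ((∫ θ in Ioc 0 (2 * π), logMajorant K θ) - 2 * π *
                circleAverage (Real.log ‖G ·‖) 0 (radiusSeq n)) * (16 / (1 - w) ^ 2 * δ) := by
              rw [integral_mul_const, integral_sub hM hUn,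
                setIntegral_eq_circleAverage (fun z => Real.log ‖G z‖)]
          -- The averages of `log|G|` are nonnegative, by Jensen's formula and `G 0 = 1`.
          _ ≤ (∫ θ in Ioc 0 (2 * π), logMajorant K θ) * (16 / (1 - w) ^ 2 * δ) := by
              refine mul_le_mul_of_nonneg_right ?_ (by positivity)
              have := h.circleAverage_nonneg (radiusSeq_pos n) hr1
              have := mul_nonneg two_pi_pos.le this
              linarith
          _ = C * δ := by rw [hC]; ring
      have h4 := integral_inter_add_sdiff hEm hvk
      linarith
    have h5 := le_of_tendsto_of_tendsto hlim2 (hlim1.add_const _) hle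
    refine h5.trans (add_le_add ?_ le_rfl)
    refine setIntegral_mono_set (integrableOn_mul_endpointKernel (hM.sub hU) hw hw1) ?_
      inter_subset_left.eventuallyLE
    filter_upwards [ae_restrict_of_ae h.ae_ne_zero] with θ hθ
    exact mul_nonneg (sub_nonneg.2 (h.log_norm_le_logMajorant zero_le_one le_rfl hθ.1))
      (endpointKernel_nonneg hw hw1 θ)
  have hlim : Tendsto (fun δ : ℝ => (∫ θ in Ioc 0 (2 * π),
      (logMajorant K θ - Real.log ‖G (circleMap 0 1 θ)‖) * endpointKernel 1 w θ) + C * δ)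
      (𝓝[>] 0) (𝓝 ((∫ θ in Ioc 0 (2 * π),
      (logMajorant K θ - Real.log ‖G (circleMap 0 1 θ)‖) * endpointKernel 1 w θ) + C * 0)) :=
    (Continuous.tendsto (by fun_prop) 0).mono_left nhdsWithin_le_nhds
  have h1 := ge_of_tendsto hlim (eventually_mem_nhdsWithin.mono key)
  have h2 : ∫ θ in Ioc 0 (2 * π), (logMajorant K θ - Real.log ‖G (circleMap 0 1 θ)‖)
      * endpointKernel 1 w θ
      = (∫ θ in Ioc 0 (2 * π), logMajorant K θ * endpointKernel 1 w θ)
      - ∫ θ in Ioc 0 (2 * π), Real.log ‖G (circleMap 0 1 θ)‖ * endpointKernel 1 w θ := by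
    simp_rw [sub_mul]
    exact integral_sub (integrableOn_mul_endpointKernel hM hw hw1)
      (integrableOn_mul_endpointKernel hU hw hw1)
  linarith

/-- Let `w → 1`: the kernel tends to `1` boundedly off `-1`, and the error term `(1 - w)/(1 + w) *
log w` tends to `0`. -/
lemma circleAverage_le_tsum (h : IsDiscAdmissible G K) :
    circleAverage (Real.log ‖G ·‖) 0 1 ≤ ∑' z : ball (0 : ℂ) 1, blaschkeTerm G z := by
  set S := ∑' z : ball (0 : ℂ) 1, blaschkeTerm G z with hSdef
  have hS : HasSum (fun z : ball (0 : ℂ) 1 => blaschkeTerm G z) S := h.summable_blaschkeTerm.hasSum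
  have hU := h.integrableOn_log_norm
  have hlim1 : Tendsto (fun n => ∫ θ in Ioc 0 (2 * π),
      Real.log ‖G (circleMap 0 1 θ)‖ * endpointKernel 1 (radiusSeq n) θ) atTop
      (𝓝 (∫ θ in Ioc 0 (2 * π), Real.log ‖G (circleMap 0 1 θ)‖ * 1)) := by
    refine tendsto_integral_of_dominated_convergence
      (fun θ => ‖Real.log ‖G (circleMap 0 1 θ)‖‖) (fun n => ?_) hU.norm (fun n => ?_) ?_
    · exact (integrableOn_mul_endpointKernel hU (radiusSeq_pos n)
        (radiusSeq_lt_one n)).aestronglyMeasurable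
    · refine Eventually.of_forall fun θ => ?_
      rw [norm_mul]
      refine mul_le_of_le_one_right (norm_nonneg _) ?_
      rw [Real.norm_eq_abs,
        abs_of_nonneg (endpointKernel_nonneg (radiusSeq_pos n) (radiusSeq_lt_one n) θ)]
      exact endpointKernel_le_one _ _ _
    · filter_upwards [ae_restrict_of_ae h.ae_ne_zero] with θ hθ
      exact tendsto_const_nhds.mul ((tendsto_endpointKernel_one hθ.1).comp tendsto_radiusSeq)
  have hlim2 : Tendsto (fun n => 2 * π * (S - (1 - radiusSeq n) / (1 + radiusSeq n)
      * Real.log (radiusSeq n))) atTop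
      (𝓝 (2 * π * (S - (1 - 1) / (1 + 1) * Real.log 1))) := by
    have hlog : Tendsto (fun n => Real.log (radiusSeq n)) atTop (𝓝 (Real.log 1)) :=
      (Real.continuousAt_log one_ne_zero).tendsto.comp tendsto_radiusSeq
    refine Tendsto.const_mul _ (tendsto_const_nhds.sub (Tendsto.mul ?_ hlog))
    exact (tendsto_radiusSeq.const_sub 1).div (tendsto_radiusSeq.const_add 1) (by norm_num)
  have h1 := le_of_tendsto_of_tendsto' hlim1 hlim2 fun n =>
    h.setIntegral_boundary_mul_endpointKernel_le (radiusSeq_pos n) (radiusSeq_lt_one n) hS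
  simp only [mul_one, Real.log_one, mul_zero, sub_zero] at h1
  rw [setIntegral_eq_circleAverage (fun z => Real.log ‖G z‖)] at h1
  exact le_of_mul_le_mul_left h1 two_pi_pos

/-- The circle average of `log ‖G‖` over the unit circle is the full Blaschke sum. -/
theorem tsum_blaschkeTerm_eq (h : IsDiscAdmissible G K) :
    ∑' z : ball (0 : ℂ) 1, blaschkeTerm G z = circleAverage (Real.log ‖G ·‖) 0 1 :=
  h.tsum_blaschkeTerm_le.antisymm h.circleAverage_le_tsum

end IsDiscAdmissible

/-! ### Growth of `(s - 1) ζ(s)` on `Re s ≥ 1/2` -/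

/-- The fractional part on `(1, ∞)`, extended by zero. -/
noncomputable def fractIoi (t : ℝ) : ℂ := (Ioi (1 : ℝ)).indicator (fun t => ((Int.fract t : ℝ) : ℂ)) t

lemma norm_fractIoi_le_one (t : ℝ) : ‖fractIoi t‖ ≤ 1 := by
  unfold fractIoi
  by_cases ht : t ∈ Ioi (1 : ℝ)
  · rw [indicator_of_mem ht, Complex.norm_real, Real.norm_eq_abs, abs_of_nonneg (Int.fract_nonneg t)]
    exact (Int.fract_lt_one t).le
  · rw [indicator_of_notMem ht]; simp

lemma measurable_fractIoi : Measurable fractIoi :=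
  (Complex.measurable_ofReal.comp measurable_fract).indicator measurableSet_Ioi

lemma mellin_fractIoi_eq (s : ℂ) :
    mellin fractIoi (-s) = ∫ t in Ioi (1 : ℝ), (t : ℂ) ^ (-(s + 1)) * ((Int.fract t : ℝ) : ℂ) := by
  rw [mellin, ← integral_indicator measurableSet_Ioi, ← integral_indicator measurableSet_Ioi]
  refine integral_congr_ae (Eventually.of_forall fun t => ?_)
  simp only [fractIoi, indicator_apply, mem_Ioi]
  by_cases h1 : 1 < t
  · rw [if_pos h1, if_pos h1, if_pos (zero_lt_one.trans h1), smul_eq_mul, neg_add']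
  · rw [if_neg h1, if_neg h1, smul_zero, ite_self]

lemma differentiableAt_mellin_fractIoi {s : ℂ} (hs : 0 < s.re) :
    DifferentiableAt ℂ (fun s => mellin fractIoi (-s)) s := by
  have h1 : DifferentiableAt ℂ (mellin fractIoi) (-s) := by
    -- The function is bounded at infinity, so `a = 0`; it vanishes near `0`, so any `b < -s.re`
    -- serves.
    refine mellin_differentiableAt_of_isBigO_rpow (a := 0) (b := -s.re - 1) ?_ ?_ ?_ ?_ ?_
    · refine LocallyIntegrable.locallyIntegrableOn ?_ _
      refine (locallyIntegrable_const (1 : ℝ)).mono measurable_fractIoi.aestronglyMeasurable ?_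
      exact Eventually.of_forall fun t => by simpa using norm_fractIoi_le_one t
    · refine Asymptotics.IsBigO.of_bound 1 (Eventually.of_forall fun t => ?_)
      simpa using norm_fractIoi_le_one t
    · simpa using hs
    · refine Asymptotics.IsBigO.of_bound 1 ?_
      filter_upwards [nhdsWithin_le_nhds (Iio_mem_nhds (zero_lt_one : (0 : ℝ) < 1))] with t ht
      rw [fractIoi, indicator_of_notMem (by simpa using le_of_lt ht), norm_zero]
      positivity
    · simp
  exact h1.comp s differentiableAt_id.neg

lemma norm_mellin_fractIoi_le {s : ℂ} (hs : 0 < s.re) : ‖mellin fractIoi (-s)‖ ≤ 1 / s.re := by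
  rw [mellin_fractIoi_eq]
  have hlt : -(s.re + 1) < -1 := by linarith
  have hI := integrableOn_Ioi_rpow_of_lt hlt zero_lt_one
  calc ‖∫ t in Ioi (1 : ℝ), (t : ℂ) ^ (-(s + 1)) * ((Int.fract t : ℝ) : ℂ)‖
      ≤ ∫ t in Ioi (1 : ℝ), t ^ (-(s.re + 1)) := by
        refine norm_integral_le_of_norm_le hI ?_
        filter_upwards [ae_restrict_mem measurableSet_Ioi] with t ht
        have ht0 : 0 < t := zero_lt_one.trans ht
        rw [norm_mul, Complex.norm_cpow_eq_rpow_re_of_pos ht0, Complex.norm_real, Real.norm_eq_abs,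
          abs_of_nonneg (Int.fract_nonneg t)]
        simp only [neg_re, add_re, one_re]
        exact mul_le_of_le_one_right (by positivity) (Int.fract_lt_one t).le
    _ = 1 / s.re := by
        rw [integral_Ioi_rpow_of_lt hlt zero_lt_one, Real.one_rpow,
          show -(s.re + 1) + 1 = -s.re by ring, neg_div_neg_eq]

/-- Abel summation gives `ζ(s) = s ∫ ⌊t⌋ t^(-s-1) dt` over `t > 1`; split `⌊t⌋ = t - {t}`. -/
lemma riemannZeta_eq_sub_mellin {s : ℂ} (hs : 1 < s.re) :
    riemannZeta s = s / (s - 1) - s * mellin fractIoi (-s) := by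
  have h0 : (fun n : ℕ => ∑ k ∈ Finset.Icc 1 n, ‖(1 : ℕ → ℂ) k‖) =O[atTop]
      fun n => (n : ℝ) ^ (1 : ℝ) := by
    refine Asymptotics.IsBigO.of_bound 1 (Eventually.of_forall fun n => ?_)
    simp
  have hs1 : s - 1 ≠ 0 := fun h => by
    have := congrArg re h
    simp at this; linarith
  have hre : (-s).re < -1 := by simpa using hs
  have h1 := LSeries_eq_mul_integral' 1 zero_le_one hs h0
  rw [LSeries_one_eq_riemannZeta hs] at h1
  have hI1 := integrableOn_Ioi_cpow_of_lt hre zero_lt_one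
  have hI2 : IntegrableOn (fun t : ℝ => (t : ℂ) ^ (-(s + 1)) * ((Int.fract t : ℝ) : ℂ)) (Ioi 1) := by
    have hre2 : (-(s + 1)).re < -1 := by simp; linarith
    refine (integrableOn_Ioi_cpow_of_lt hre2 zero_lt_one).mul_bdd (c := 1)
      (Complex.measurable_ofReal.comp measurable_fract).aestronglyMeasurable ?_
    refine Eventually.of_forall fun t => ?_
    rw [Complex.norm_real, Real.norm_eq_abs, abs_of_nonneg (Int.fract_nonneg t)]
    exact (Int.fract_lt_one t).le
  have h2 : ∫ t in Ioi (1 : ℝ), (∑ k ∈ Finset.Icc 1 ⌊t⌋₊, (1 : ℕ → ℂ) k) * (t : ℂ) ^ (-(s + 1))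
      = (∫ t in Ioi (1 : ℝ), (t : ℂ) ^ (-s)) - mellin fractIoi (-s) := by
    rw [mellin_fractIoi_eq, ← integral_sub hI1 hI2]
    refine setIntegral_congr_fun measurableSet_Ioi fun t ht => ?_
    have ht0 : (0 : ℝ) < t := zero_lt_one.trans ht
    have htc : (t : ℂ) ≠ 0 := by exact_mod_cast ht0.ne'
    have e1 : (t : ℂ) ^ (-s) = t * (t : ℂ) ^ (-(s + 1)) := by
      rw [show -s = 1 + -(s + 1) by ring, Complex.cpow_add _ _ htc, Complex.cpow_one]
    have e2 : ((Int.fract t : ℝ) : ℂ) = (t : ℂ) - (⌊t⌋₊ : ℂ) := by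
      have : Int.fract t = t - (⌊t⌋₊ : ℝ) := by
        rw [Int.fract, ← natCast_floor_eq_intCast_floor ht0.le]
      rw [this]; push_cast; rfl
    simp only [Pi.one_apply, Finset.sum_const, Nat.card_Icc, add_tsub_cancel_right, nsmul_eq_mul,
      mul_one]
    rw [e1, e2]; ring
  rw [h1, h2, integral_Ioi_cpow_of_lt hre zero_lt_one, Complex.ofReal_one, Complex.one_cpow]
  have : -s + 1 ≠ 0 := by
    intro h; apply hs1; linear_combination -h
  field_simp
  ring

lemma riemannZeta₁_eq_sub_mellin {s : ℂ} (hs : 0 < s.re) :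
    riemannZeta₁ s = s - s * (s - 1) * mellin fractIoi (-s) := by
  have hU : IsOpen {s : ℂ | 0 < s.re} := isOpen_lt continuous_const Complex.continuous_re
  have hf : AnalyticOnNhd ℂ riemannZeta₁ {s : ℂ | 0 < s.re} :=
    differentiable_riemannZeta₁.differentiableOn.analyticOnNhd hU
  have hg : AnalyticOnNhd ℂ (fun s => s - s * (s - 1) * mellin fractIoi (-s))
      {s : ℂ | 0 < s.re} := by
    refine DifferentiableOn.analyticOnNhd (fun s hs => ?_) hU
    have := differentiableAt_mellin_fractIoi hs
    exact DifferentiableAt.differentiableWithinAt (by fun_prop)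
  refine hf.eqOn_of_preconnected_of_eventuallyEq hg
    (convex_halfSpace_re_gt 0).isPreconnected (z₀ := 2) (by simp) ?_ hs
  have hV : {s : ℂ | 1 < s.re} ∈ 𝓝 (2 : ℂ) :=
    (isOpen_lt continuous_const Complex.continuous_re).mem_nhds (by simp)
  filter_upwards [hV] with s hs
  have hs' : 1 < s.re := hs
  have hs1 : s - 1 ≠ 0 := fun h => by
    have := congrArg re h
    simp at this; linarith
  have h1 := riemannZeta_eq_sub_mellin hs'
  rw [riemannZeta_eq_inv_sub_mul (sub_ne_zero.1 hs1)] at h1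
  field_simp at h1
  linear_combination h1

/-- The Mellin term is at most `2`, `|s - 1| ≤ |s|`, and `|s| ≤ 2|s|²` because `|s| ≥ 1/2`. -/
lemma norm_riemannZeta₁_le {s : ℂ} (hs : 1 / 2 ≤ s.re) : ‖riemannZeta₁ s‖ ≤ 4 * ‖s‖ ^ 2 := by
  have hs0 : 0 < s.re := by linarith
  have h1 : ‖s - 1‖ ≤ ‖s‖ := by
    refine le_of_sq_le_sq ?_ (norm_nonneg _)
    rw [← Complex.normSq_eq_norm_sq, ← Complex.normSq_eq_norm_sq, Complex.normSq_apply,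
      Complex.normSq_apply]
    simp
    nlinarith
  have h2 : 1 / 2 ≤ ‖s‖ := hs.trans (Complex.re_le_norm s)
  have h3 : ‖mellin fractIoi (-s)‖ ≤ 2 := by
    refine (norm_mellin_fractIoi_le hs0).trans ?_
    rw [div_le_iff₀ hs0]; linarith
  rw [riemannZeta₁_eq_sub_mellin hs0]
  refine (norm_sub_le _ _).trans ?_
  rw [norm_mul, norm_mul]
  have h4 : ‖s‖ * ‖s - 1‖ * ‖mellin fractIoi (-s)‖ ≤ ‖s‖ * ‖s‖ * 2 := by gcongr
  nlinarith

lemma one_le_norm_riemannZeta_ofReal {x : ℝ} (hx : 1 < x) : 1 ≤ ‖riemannZeta x‖ := by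
  have hx' : 1 < (x : ℂ).re := by simpa
  have h1 : riemannZeta x = ((∑' n : ℕ, 1 / ((n : ℝ) + 1) ^ x : ℝ) : ℂ) := by
    rw [zeta_eq_tsum_one_div_nat_add_one_cpow hx', Complex.ofReal_tsum]
    refine tsum_congr fun n => ?_
    rw [Complex.ofReal_div, Complex.ofReal_cpow (by positivity)]
    push_cast
    rfl
  have hsum : Summable fun n : ℕ => 1 / ((n : ℝ) + 1) ^ x := by
    have := (summable_nat_add_iff 1).2 (Real.summable_one_div_nat_rpow.2 hx)
    simpa using this
  have h2 : 1 ≤ ∑' n : ℕ, 1 / ((n : ℝ) + 1) ^ x := by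
    have := hsum.le_tsum 0 (fun n _ => by positivity)
    simpa using this
  rw [h1, Complex.norm_real, Real.norm_eq_abs]
  exact h2.trans (le_abs_self _)

/-! ### Transport of zeta to the unit disc -/

/-- The entire function `(s - 1) ζ(s)` divided by `s`, transported to the unit disc through
`z = (1 - s) / s`. -/
noncomputable def zetaDisc (z : ℂ) : ℂ := (1 + z) * riemannZeta₁ (1 + z)⁻¹

lemma one_add_ne_zero_of_ne {z : ℂ} (hz : z ≠ -1) : 1 + z ≠ 0 := fun h =>
  hz (by linear_combination h)

lemma half_le_re_inv_one_add {z : ℂ} (hz : ‖z‖ ≤ 1) (hz1 : z ≠ -1) :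
    1 / 2 ≤ ((1 + z)⁻¹).re := by
  have h0 := one_add_ne_zero_of_ne hz1
  have h1 : 0 < Complex.normSq (1 + z) := Complex.normSq_pos.2 h0
  rw [Complex.inv_re, le_div_iff₀ h1]
  have h2 : Complex.normSq z ≤ 1 := by
    rw [Complex.normSq_eq_norm_sq]
    exact pow_le_one₀ (norm_nonneg z) hz
  simp only [Complex.normSq_apply, add_re, one_re, add_im, one_im, zero_add] at h2 ⊢
  nlinarith

lemma isDiscAdmissible_zetaDisc : IsDiscAdmissible zetaDisc 4 where
  analytic := by
    refine DifferentiableOn.analyticOnNhd (fun z hz => ?_) isOpen_compl_singleton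
    have h0 := one_add_ne_zero_of_ne hz
    unfold zetaDisc
    have h1 : DifferentiableAt ℂ (fun z : ℂ => (1 + z)⁻¹) z := by fun_prop (disch := exact h0)
    have h2 : DifferentiableAt ℂ (fun z : ℂ => riemannZeta₁ (1 + z)⁻¹) z :=
      (differentiable_riemannZeta₁ _).comp z h1
    exact ((differentiableAt_id.const_add 1).mul h2).differentiableWithinAt
  map_zero := by simp [zetaDisc]
  one_le := by norm_num
  bound := by
    intro z hz hz1
    have h0 : 0 < ‖1 + z‖ := norm_pos_iff.2 (one_add_ne_zero_of_ne hz1)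
    rw [zetaDisc, norm_mul, le_div_iff₀ h0]
    have h1 := norm_riemannZeta₁_le (half_le_re_inv_one_add hz hz1)
    rw [norm_inv] at h1
    calc ‖1 + z‖ * ‖riemannZeta₁ (1 + z)⁻¹‖ * ‖1 + z‖
        ≤ ‖1 + z‖ * (4 * ‖1 + z‖⁻¹ ^ 2) * ‖1 + z‖ := by gcongr
      _ = 4 := by field_simp
  -- At `z = -w` the point is `s = 1/(1 - w) > 1`, and `G(-w) = w ζ(s)`.
  lower := by
    intro w hw hw1
    have h1 : (0 : ℝ) < 1 - w := by linarith
    have hc : (1 + -(w : ℂ)) = ((1 - w : ℝ) : ℂ) := by push_cast; ring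
    have hne : ((1 - w : ℝ) : ℂ) ≠ 0 := by exact_mod_cast h1.ne'
    have hx : 1 < (1 - w)⁻¹ := (one_lt_inv₀ h1).2 (by linarith)
    have h2 := one_le_norm_riemannZeta_ofReal hx
    have hne1 : (((1 - w)⁻¹ : ℝ) : ℂ) ≠ 1 := by exact_mod_cast hx.ne'
    have h3 := riemannZeta_eq_inv_sub_mul hne1
    have h4 : riemannZeta₁ (((1 - w)⁻¹ : ℝ) : ℂ)
        = ((((1 - w)⁻¹ : ℝ) : ℂ) - 1) * riemannZeta (((1 - w)⁻¹ : ℝ) : ℂ) := by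
      rw [h3, mul_inv_cancel_left₀ (sub_ne_zero.2 hne1)]
    have h5 : zetaDisc (-w) = (w : ℂ) * riemannZeta (((1 - w)⁻¹ : ℝ) : ℂ) := by
      rw [zetaDisc, hc, ← Complex.ofReal_inv, h4, ← mul_assoc]
      congr 1
      push_cast at hne ⊢
      field_simp
      ring
    rw [h5, norm_mul, Complex.norm_real, Real.norm_eq_abs, abs_of_pos hw]
    exact le_mul_of_one_le_right hw.le h2

lemma riemannZeta₁_eq_sub_one_mul {s : ℂ} (hs : s ≠ 1) :
    riemannZeta₁ s = (s - 1) * riemannZeta s := by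
  rw [riemannZeta_eq_inv_sub_mul hs, mul_inv_cancel_left₀ (sub_ne_zero.2 hs)]

lemma analyticOrderAt_riemannZeta₁ {s : ℂ} (hs : s ≠ 1) :
    analyticOrderAt riemannZeta₁ s = analyticOrderAt riemannZeta s := by
  have h1 : riemannZeta₁ =ᶠ[𝓝 s] (fun s => s - 1) * riemannZeta := by
    filter_upwards [isOpen_ne.mem_nhds hs] with x hx using riemannZeta₁_eq_sub_one_mul hx
  have ha : AnalyticAt ℂ riemannZeta s := analyticOn_riemannZeta s hs
  have hb : AnalyticAt ℂ (fun s : ℂ => s - 1) s := by fun_prop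
  rw [analyticOrderAt_congr h1, analyticOrderAt_mul hb ha,
    hb.analyticOrderAt_eq_zero.2 (sub_ne_zero.2 hs), zero_add]

/-- Multiplicities are preserved: the factor `1 + z` is nonzero and `(1 + z)⁻¹` has nonvanishing
derivative. -/
lemma analyticOrderAt_zetaDisc {z : ℂ} (hz : z ≠ -1) :
    analyticOrderAt zetaDisc z = analyticOrderAt riemannZeta₁ (1 + z)⁻¹ := by
  have h0 := one_add_ne_zero_of_ne hz
  have hi : AnalyticAt ℂ (fun z : ℂ => (1 + z)⁻¹) z := by
    exact (analyticAt_const.add analyticAt_id).inv h0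
  have hd : deriv (fun z : ℂ => (1 + z)⁻¹) z ≠ 0 := by
    have := ((hasDerivAt_id z).const_add 1).inv (x := z) h0
    have h2 : HasDerivAt (fun z : ℂ => (1 + z)⁻¹) (-1 / (1 + z) ^ 2) z := this
    rw [h2.deriv]
    exact div_ne_zero (by norm_num) (pow_ne_zero _ h0)
  have ha : AnalyticAt ℂ (fun z : ℂ => 1 + z) z := by fun_prop
  have hz₁ : AnalyticAt ℂ riemannZeta₁ (1 + z)⁻¹ :=
    differentiable_riemannZeta₁.analyticAt _
  have hc : AnalyticAt ℂ (riemannZeta₁ ∘ fun z : ℂ => (1 + z)⁻¹) z :=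
    AnalyticAt.comp (f := fun z : ℂ => (1 + z)⁻¹) hz₁ hi
  have e : zetaDisc = (fun z : ℂ => 1 + z) * (riemannZeta₁ ∘ fun z : ℂ => (1 + z)⁻¹) := rfl
  rw [e, analyticOrderAt_mul ha hc, ha.analyticOrderAt_eq_zero.2 h0, zero_add,
    analyticOrderAt_comp_of_deriv_ne_zero hi hd]

lemma norm_one_sub_lt_norm {s : ℂ} (hs : 1 / 2 < s.re) : ‖1 - s‖ < ‖s‖ := by
  refine lt_of_pow_lt_pow_left₀ 2 (norm_nonneg _) ?_
  rw [← Complex.normSq_eq_norm_sq, ← Complex.normSq_eq_norm_sq, Complex.normSq_apply,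
    Complex.normSq_apply]
  simp
  nlinarith

lemma ne_zero_of_half_lt_re {s : ℂ} (hs : 1 / 2 < s.re) : s ≠ 0 := by
  rintro rfl
  simp at hs
  linarith

/-- The point of the unit disc attached to a zero in the right half of the critical strip. -/
noncomputable def zetaZeroToDisc (ρ : zetaZerosRightHalf) : ball (0 : ℂ) 1 :=
  ⟨(1 - (ρ : ℂ)) / ρ, by
    have h1 := norm_one_sub_lt_norm ρ.2.2
    rw [mem_ball_zero_iff, norm_div, div_lt_one ((norm_nonneg _).trans_lt h1)]
    exact h1⟩

lemma one_add_zetaZeroToDisc (ρ : zetaZerosRightHalf) :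
    (1 + (zetaZeroToDisc ρ : ℂ))⁻¹ = ρ := by
  have := ne_zero_of_half_lt_re ρ.2.2
  simp only [zetaZeroToDisc]
  field_simp
  simp

lemma zetaZeroToDisc_injective : Function.Injective zetaZeroToDisc := fun ρ ρ' h => by
  apply Subtype.ext
  rw [← one_add_zetaZeroToDisc ρ, h, one_add_zetaZeroToDisc]

lemma ne_neg_one_of_mem_ball {z : ℂ} (hz : z ∈ ball (0 : ℂ) 1) : z ≠ -1 := by
  rintro rfl
  simp at hz

lemma blaschkeTerm_zetaZeroToDisc (ρ : zetaZerosRightHalf) :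
    blaschkeTerm zetaDisc (zetaZeroToDisc ρ) =
      (zetaZeroMult (ρ : ℂ) : ℝ) * Real.log ‖(ρ : ℂ) / (1 - (ρ : ℂ))‖ := by
  rw [blaschkeTerm, zetaZeroMult, analyticOrderNatAt, analyticOrderNatAt,
    analyticOrderAt_zetaDisc (ne_neg_one_of_mem_ball (zetaZeroToDisc ρ).2),
    one_add_zetaZeroToDisc, analyticOrderAt_riemannZeta₁ ρ.2.1.2.2, ← Real.log_inv, ← norm_inv]
  simp only [zetaZeroToDisc, inv_div]

lemma mem_range_zetaZeroToDisc {z : ball (0 : ℂ) 1} (hz : blaschkeTerm zetaDisc z ≠ 0) :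
    z ∈ range zetaZeroToDisc := by
  have hz1 := ne_neg_one_of_mem_ball z.2
  have h0 := one_add_ne_zero_of_ne hz1
  have hzn := mem_ball_zero_iff.1 z.2
  rw [blaschkeTerm, mul_ne_zero_iff, neg_ne_zero] at hz
  -- The term at `0` is zero because `log 0 = 0`. This excludes `s = 1`, where `ζ` has only a
  -- conventional value.
  have hzz : (z : ℂ) ≠ 0 := by
    intro h
    rw [h] at hz
    simp at hz
  have hG : zetaDisc z = 0 := by
    by_contra h
    apply hz.1
    rw [analyticOrderNatAt, (isDiscAdmissible_zetaDisc.analytic _ hz1).analyticOrderAt_eq_zero.2 h]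
    simp
  set ρ : ℂ := (1 + (z : ℂ))⁻¹ with hρ
  have hρ0 : ρ ≠ 0 := inv_ne_zero h0
  have hzρ : (z : ℂ) = (1 - ρ) / ρ := by
    rw [hρ]; field_simp; ring
  have hρ1 : ρ ≠ 1 := by
    intro h
    rw [h] at hzρ
    simp at hzρ
    exact hzz (congrArg Subtype.val hzρ)
  have hζ : riemannZeta ρ = 0 := by
    rw [riemannZeta_eq_inv_sub_mul hρ1]
    rw [zetaDisc] at hG
    rw [(mul_eq_zero.1 hG).resolve_left h0, mul_zero]
  have hre : 1 / 2 < ρ.re := by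
    have h3 : ‖1 - ρ‖ < ‖ρ‖ := by
      rw [hzρ, norm_div, div_lt_one (norm_pos_iff.2 hρ0)] at hzn
      exact hzn
    have h4 := pow_lt_pow_left₀ h3 (norm_nonneg _) two_ne_zero
    rw [← Complex.normSq_eq_norm_sq, ← Complex.normSq_eq_norm_sq, Complex.normSq_apply,
      Complex.normSq_apply] at h4
    simp at h4
    nlinarith
  refine ⟨⟨ρ, ⟨hζ, ?_, hρ1⟩, hre⟩, ?_⟩
  · rintro ⟨n, hn⟩
    rw [hn] at hre
    have : ((-2 : ℂ) * (n + 1)).re = -2 * ((n : ℝ) + 1) := by simp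
    rw [this] at hre
    have : (0 : ℝ) ≤ n := Nat.cast_nonneg n
    linarith
  · apply Subtype.ext
    exact hzρ.symm

lemma summable_zetaZeros : Summable (fun ρ : zetaZerosRightHalf =>
    (zetaZeroMult (ρ : ℂ) : ℝ) * Real.log ‖(ρ : ℂ) / (1 - (ρ : ℂ))‖) := by
  have h1 := isDiscAdmissible_zetaDisc.summable_blaschkeTerm.comp_injective zetaZeroToDisc_injective
  exact h1.congr fun ρ => blaschkeTerm_zetaZeroToDisc ρ

lemma tsum_zetaZeros_eq : ∑' ρ : zetaZerosRightHalf,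
    (zetaZeroMult (ρ : ℂ) : ℝ) * Real.log ‖(ρ : ℂ) / (1 - (ρ : ℂ))‖
      = circleAverage (Real.log ‖zetaDisc ·‖) 0 1 := by
  rw [← isDiscAdmissible_zetaDisc.tsum_blaschkeTerm_eq, ← zetaZeroToDisc_injective.tsum_eq
    (f := fun z : ball (0 : ℂ) 1 => blaschkeTerm zetaDisc z)
    (fun z hz => mem_range_zetaZeroToDisc hz)]
  exact tsum_congr fun ρ => (blaschkeTerm_zetaZeroToDisc ρ).symm

/-! ### Change of variables from the critical line to the circle -/

lemma norm_criticalLine_sq (t : ℝ) : ‖criticalLine t‖ ^ 2 = 1 / 4 + t ^ 2 := by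
  rw [← Complex.normSq_eq_norm_sq, Complex.normSq_apply, criticalLine]
  simp
  ring

lemma norm_criticalLine_sub_one (t : ℝ) : ‖criticalLine t - 1‖ = ‖criticalLine t‖ := by
  have h : ‖criticalLine t - 1‖ ^ 2 = 1 / 4 + t ^ 2 := by
    rw [← Complex.normSq_eq_norm_sq, Complex.normSq_apply, criticalLine]
    simp
    ring
  rw [← norm_criticalLine_sq] at h
  exact (pow_left_inj₀ (norm_nonneg _) (norm_nonneg _) two_ne_zero).1 h

lemma criticalLine_ne_zero (t : ℝ) : criticalLine t ≠ 0 := by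
  intro h
  have := congrArg re h
  simp [criticalLine] at this

lemma criticalLine_ne_one (t : ℝ) : criticalLine t ≠ 1 := by
  intro h
  have := congrArg re h
  simp [criticalLine] at this

/-- On the line `1 - s` is the conjugate of `s`, and `arg s = arctan 2t`; hence `(1 - s)/s = exp(-2i
arctan 2t)`. -/
lemma one_add_circleMap_arctan (t : ℝ) :
    1 + circleMap 0 1 (-(2 * Real.arctan (2 * t))) = (criticalLine t)⁻¹ := by
  set α := Real.arctan (2 * t) with hα
  have hcos : Real.cos α ≠ 0 := (Real.cos_arctan_pos _).ne'
  have hsin : Real.sin α = 2 * t * Real.cos α := by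
    have := Real.tan_arctan (2 * t)
    rw [← hα, Real.tan_eq_sin_div_cos, div_eq_iff hcos] at this
    exact this
  have hsq := Real.sin_sq_add_cos_sq α
  have h1 : circleMap 0 1 (-(2 * α)) = (Real.cos (2 * α) : ℂ) - (Real.sin (2 * α) : ℂ) * I := by
    rw [circleMap, zero_add, Complex.ofReal_one, one_mul, Complex.exp_mul_I, ← Complex.ofReal_cos,
      ← Complex.ofReal_sin, Real.cos_neg, Real.sin_neg]
    push_cast
    ring
  have hmul : (1 + circleMap 0 1 (-(2 * α))) * criticalLine t = 1 := by
    rw [h1, Real.cos_two_mul, Real.sin_two_mul, hsin, criticalLine]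
    rw [hsin] at hsq
    have hsqC : (2 * (t : ℂ) * (Real.cos α : ℂ)) ^ 2 + (Real.cos α : ℂ) ^ 2 = 1 := by
      exact_mod_cast hsq
    push_cast at hsqC ⊢
    linear_combination hsqC - (4 * (t : ℂ) ^ 2 * Complex.cos α ^ 2) * I_sq
  exact eq_inv_of_mul_eq_one_left hmul

lemma norm_zetaDisc_circleMap_arctan (t : ℝ) :
    ‖zetaDisc (circleMap 0 1 (-(2 * Real.arctan (2 * t))))‖ = ‖riemannZeta (criticalLine t)‖ := by
  rw [zetaDisc, one_add_circleMap_arctan, inv_inv,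
    riemannZeta₁_eq_sub_one_mul (criticalLine_ne_one t), norm_mul, norm_mul, norm_inv,
    norm_criticalLine_sub_one, inv_mul_cancel_left₀ (norm_ne_zero_iff.2 (criticalLine_ne_zero t))]

lemma hasDerivAt_neg_two_mul_arctan (t : ℝ) :
    HasDerivAt (fun t : ℝ => -(2 * Real.arctan (2 * t))) (-(1 / 4 + t ^ 2)⁻¹) t := by
  have h1 : HasDerivAt (fun t : ℝ => 2 * t) 2 t := by simpa using (hasDerivAt_id t).const_mul 2
  have h2 := ((h1.arctan).const_mul 2).neg
  refine h2.congr_deriv ?_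
  have h3 : 1 / 4 + t ^ 2 ≠ 0 := by positivity
  have h4 : 1 + (2 * t) ^ 2 ≠ 0 := by positivity
  field_simp
  ring

lemma image_neg_two_mul_arctan :
    (fun t : ℝ => -(2 * Real.arctan (2 * t))) '' univ = Ioo (-π) π := by
  ext θ
  simp only [image_univ, mem_range, mem_Ioo]
  constructor
  · rintro ⟨t, rfl⟩
    have h1 := Real.arctan_lt_pi_div_two (2 * t)
    have h2 := Real.neg_pi_div_two_lt_arctan (2 * t)
    constructor <;> linarith
  · rintro ⟨h1, h2⟩
    refine ⟨Real.tan (-θ / 2) / 2, ?_⟩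
    rw [mul_div_cancel₀ _ two_ne_zero, Real.arctan_tan (by linarith) (by linarith)]
    ring

lemma bsyIntegrand_criticalLine (t : ℝ) :
    bsyIntegrand (criticalLine t) = |-(1 / 4 + t ^ 2)⁻¹| •
      Real.log ‖zetaDisc (circleMap 0 1 (-(2 * Real.arctan (2 * t))))‖ := by
  have : 0 < (1 / 4 + t ^ 2)⁻¹ := by positivity
  rw [bsyIntegrand, norm_zetaDisc_circleMap_arctan, norm_criticalLine_sq, abs_neg,
    abs_of_pos this, smul_eq_mul, div_eq_inv_mul]

lemma injOn_neg_two_mul_arctan : InjOn (fun t : ℝ => -(2 * Real.arctan (2 * t))) univ := by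
  intro a _ b _ hab
  have : Real.arctan (2 * a) = Real.arctan (2 * b) := by
    simp only at hab; linarith
  linarith [Real.arctan_injective this]

lemma periodic_log_norm_circleMap (f : ℂ → ℂ) :
    Function.Periodic (fun θ => Real.log ‖f (circleMap 0 1 θ)‖) (2 * π) := fun θ => by
  simp only [periodic_circleMap 0 1 θ]

lemma intervalIntegrable_log_norm_zetaDisc :
    IntervalIntegrable (fun θ => Real.log ‖zetaDisc (circleMap 0 1 θ)‖) volume (-π) π := by
  refine (periodic_log_norm_circleMap zetaDisc).intervalIntegrable two_pi_pos.ne' (t := 0) ?_ _ _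
  rw [zero_add]
  exact (intervalIntegrable_iff_integrableOn_Ioc_of_le two_pi_pos.le).2
    isDiscAdmissible_zetaDisc.integrableOn_log_norm

lemma integrable_bsyIntegrand : Integrable (fun t : ℝ => bsyIntegrand (criticalLine t)) := by
  have h1 := integrableOn_image_iff_integrableOn_abs_deriv_smul MeasurableSet.univ
    (fun t _ => (hasDerivAt_neg_two_mul_arctan t).hasDerivWithinAt) injOn_neg_two_mul_arctan
    (fun θ => Real.log ‖zetaDisc (circleMap 0 1 θ)‖)
  rw [image_neg_two_mul_arctan, integrableOn_univ] at h1
  simp_rw [bsyIntegrand_criticalLine]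
  refine h1.1 ?_
  exact ((intervalIntegrable_iff_integrableOn_Ioc_of_le (by linarith [pi_pos])).1
    intervalIntegrable_log_norm_zetaDisc).mono_set Ioo_subset_Ioc_self

lemma integral_bsyIntegrand_eq : ∫ t : ℝ, bsyIntegrand (criticalLine t)
    = 2 * π * circleAverage (Real.log ‖zetaDisc ·‖) 0 1 := by
  have h1 := integral_image_eq_integral_abs_deriv_smul MeasurableSet.univ
    (fun t _ => (hasDerivAt_neg_two_mul_arctan t).hasDerivWithinAt) injOn_neg_two_mul_arctan
    (fun θ => Real.log ‖zetaDisc (circleMap 0 1 θ)‖)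
  rw [image_neg_two_mul_arctan, setIntegral_univ] at h1
  simp_rw [bsyIntegrand_criticalLine]
  rw [← h1, ← integral_Ioc_eq_integral_Ioo,
    ← intervalIntegral.integral_of_le (by linarith [pi_pos]),
    ← setIntegral_eq_circleAverage (fun z => Real.log ‖zetaDisc z‖),
    ← intervalIntegral.integral_of_le two_pi_pos.le]
  have h2 := (periodic_log_norm_circleMap zetaDisc).intervalIntegral_add_eq (-π) 0
  rw [zero_add, show -π + 2 * π = π by ring] at h2
  exact h2

/-! ### The Riemann Hypothesis criterion -/

lemma riemannZeta_one_sub_eq_zero {ρ : ℂ} (h0 : riemannZeta ρ = 0)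
    (htriv : ¬∃ n : ℕ, ρ = -2 * (n + 1)) (h1 : ρ ≠ 1) : riemannZeta (1 - ρ) = 0 := by
  have hρ0 : ρ ≠ 0 := by
    rintro rfl
    rw [riemannZeta_zero] at h0
    norm_num at h0
  have hΓ : Gammaℝ ρ ≠ 0 := by
    rw [Ne, Gammaℝ_eq_zero_iff]
    rintro ⟨n, hn⟩
    -- The pole of `Gammaℝ` at `0` is excluded by `ζ(0) ≠ 0`; its other poles are the trivial zeros.
    rcases n with _ | n
    · simp at hn; exact hρ0 hn
    · exact htriv ⟨n, by rw [hn]; push_cast; ring⟩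
  rw [riemannZeta_def_of_ne_zero hρ0, div_eq_zero_iff] at h0
  rw [riemannZeta_def_of_ne_zero (sub_ne_zero.2 h1.symm), completedRiemannZeta_one_sub,
    h0.resolve_right hΓ, zero_div]

lemma riemannHypothesis_iff_isEmpty : RiemannHypothesis ↔ IsEmpty zetaZerosRightHalf := by
  constructor
  · intro hRH
    refine ⟨fun ρ => ?_⟩
    have h1 := hRH ρ ρ.2.1.1 ρ.2.1.2.1 ρ.2.1.2.2
    exact (ρ.2.2).ne' h1
  · intro hE s hs htriv hs1
    have key : ∀ s : ℂ, riemannZeta s = 0 → s ≠ 1 → s.re ≤ 1 / 2 := by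
      intro s hs hs1
      by_contra! hlt
      refine hE.false ⟨s, ⟨hs, ?_, hs1⟩, hlt⟩
      rintro ⟨n, rfl⟩
      have h1 : ((-2 : ℂ) * (n + 1)).re = -2 * ((n : ℝ) + 1) := by simp
      rw [h1] at hlt
      have : (0 : ℝ) ≤ n := Nat.cast_nonneg n
      linarith
    refine le_antisymm (key s hs hs1) ?_
    have hs0 : s ≠ 0 := by
      rintro rfl
      rw [riemannZeta_zero] at hs
      norm_num at hs
    have := key (1 - s) (riemannZeta_one_sub_eq_zero hs htriv hs1) (by simpa using hs0)
    simp only [sub_re, one_re] at this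
    linarith

lemma zetaZeros_term_pos (ρ : zetaZerosRightHalf) :
    0 < (zetaZeroMult (ρ : ℂ) : ℝ) * Real.log ‖(ρ : ℂ) / (1 - (ρ : ℂ))‖ := by
  have hlt := norm_one_sub_lt_norm ρ.2.2
  have hpos : 0 < ‖1 - (ρ : ℂ)‖ := norm_pos_iff.2 (sub_ne_zero.2 ρ.2.1.2.2.symm)
  refine mul_pos ?_ (Real.log_pos ?_)
  · have ha : AnalyticAt ℂ riemannZeta (ρ : ℂ) := analyticOn_riemannZeta _ ρ.2.1.2.2
    have hne : analyticOrderAt riemannZeta (ρ : ℂ) ≠ 0 :=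
      ha.analyticOrderAt_ne_zero.2 ρ.2.1.1
    -- An infinite order would be truncated to multiplicity `0`; it is excluded because `zetaDisc`
    -- is not identically zero.
    have htop : analyticOrderAt riemannZeta (ρ : ℂ) ≠ ⊤ := by
      have h1 := isDiscAdmissible_zetaDisc.analyticOrderAt_ne_top
        (ne_neg_one_of_mem_ball (zetaZeroToDisc ρ).2)
      rwa [analyticOrderAt_zetaDisc (ne_neg_one_of_mem_ball (zetaZeroToDisc ρ).2),
        one_add_zetaZeroToDisc, analyticOrderAt_riemannZeta₁ ρ.2.1.2.2] at h1
    rw [zetaZeroMult, analyticOrderNatAt, Nat.cast_pos, Nat.pos_iff_ne_zero, Ne,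
      ENat.toNat_eq_zero]
    exact not_or.2 ⟨hne, htop⟩
  · rw [norm_div, one_lt_div hpos]
    exact hlt

theorem mainTheorem5 :
    MeasureTheory.Integrable (fun t : ℝ => bsyIntegrand (criticalLine t)) MeasureTheory.volume ∧
    Summable (fun ρ : zetaZerosRightHalf =>
      (zetaZeroMult (ρ : ℂ) : ℝ) * Real.log ‖(ρ : ℂ) / (1 - (ρ : ℂ))‖) ∧
    (∫ t : ℝ, bsyIntegrand (criticalLine t)) =
      2 * Real.pi * ∑' ρ : zetaZerosRightHalf,
        (zetaZeroMult (ρ : ℂ) : ℝ) * Real.log ‖(ρ : ℂ) / (1 - (ρ : ℂ))‖ ∧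
    (RiemannHypothesis ↔ (∫ t : ℝ, bsyIntegrand (criticalLine t)) = 0) := by
  have hEq := integral_bsyIntegrand_eq
  rw [← tsum_zetaZeros_eq] at hEq
  refine ⟨integrable_bsyIntegrand, summable_zetaZeros, hEq, ?_⟩
  rw [hEq, riemannHypothesis_iff_isEmpty, mul_eq_zero, or_iff_right two_pi_pos.ne']
  constructor
  · intro _
    exact tsum_empty
  · intro h0
    by_contra hne
    rw [not_isEmpty_iff] at hne
    obtain ⟨ρ⟩ := hne
    exact (summable_zetaZeros.tsum_pos (fun ρ => (zetaZeros_term_pos ρ).le) ρ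
      (zetaZeros_term_pos ρ)).ne' h0
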